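/- Let $\rho$ be the irreducible representation of $SO(3)$ on $\mathbb R^5$, identified with the symmetric traceless real $3\times 3$ matrices by $$\mu(x)=\begin{pmatrix}\frac{x_1}{\sqrt3}-x_4&x_2&x_3\\ x_2&\frac{x_1}{\sqrt3}+x_4&x_5\\ x_3&x_5&-\frac{2x_1}{\sqrt3}\end{pmatrix},$$ $\rho(h)x=\mu^{-1}(h\mu(x)h^{-1})$, and let $\Upsilon$ be the $SO(3)$-invariant symmetric $3$-form on $\mathbb R^5$ with $\Upsilon(x,x,x)=\frac{3\sqrt3}{2}\det\mu(x)$. Let $M$ be a smooth $5$-manifold with an irreducible $SO(3)$-structure, that is, an oriented Riemannian manifold $(M,g)$ with a symmetric rank $3$ tensor $\Upsilon$ such that near every point there is a smooth oriented orthonormal frame in which $\Upsilon$ has the standard form above (a reduction of the frame bundle to $\rho(SO(3))\subset SO(5)$). Let $\nabla$ be a smooth $SO(3)$-connection on $M$ ($\nabla g=0$, $\nabla\Upsilon=0$) whose torsion $g(T(X,Y),Z)$ is totally skew-symmetric (the characteristic connection). Identify $\sigma\in\Lambda^2T_pM$ with the endomorphism given by $g(\sigma(x),y)=g(\sigma,x\wedge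 y)$, where $g(x\wedge y,u\wedge v)=g(x,u)g(y,v)-g(x,v)g(y,u)$. Let $g(\Upsilon_v x,y)=\Upsilon(v,x,y)$, and for an endomorphism $W$ of $T_pM$ let $\widehat\Upsilon(W)(x)=4\sum_{j=1}^5\Upsilon_{W(e_j)}\Upsilon_{e_j}(x)$ with $(e_j)$ an orthonormal basis. Let $\Lambda^2_3T_pM=\{F:\widehat\Upsilon(F)=7F\}$, a $3$-dimensional space of $2$-vectors. The twistor space is the $7$-manifold $$\mathbb T=\{\sigma\in\Lambda^2_3TM:\ |\sigma|^2=5\},$$ with projection $\pi:\mathbb T\to M$; the connection $\nabla$ splits $T_\sigma\mathbb T$ into the vertical space $\mathcal V_\sigma\subset\Lambda^2_3T_{\pi(\sigma)}M$ and the space of horizontal lifts $X^h_\sigma$, $X\in T_{\pi(\sigma)}M$. For $t>0$ let $h_t$ be the Riemannian metric on $\mathbb T$ with $$h_t(X^h_\sigma+V,\,Y^h_\sigma+W)=g(X,Y)+t\,g(V,W),\qquad X,Y\in T_{\pi(\sigma)}M,\ V,W\in\mathcal V_\sigma .$$ Let $\xi_\sigma=\frac14\ast(\sigma\wedge\sigma)\in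 T_{\pi(\sigma)}M$, where $\ast$ is the Hodge star operator, and let $\chi_\sigma=(\xi_\sigma)^h_\sigma$ be the characteristic vector field on $\mathbb T$. Then, for every $t>0$, every integral curve $\gamma:J\to\mathbb T$ of $\chi$ on an open interval $J$ is a geodesic of $h_t$, i.e. $D_{\gamma'}\gamma'=0$ where $D$ is the Levi-Civita connection of $h_t$. -/

import Mathlib

open Bundle Set Module
open scoped Manifold ContDiff Topology

noncomputable section

/-! ## Linear algebra of one oriented Euclidean 5-space

A 2-vector `σ ∈ Λ²V` is represented by the endomorphism `S` with `⟪S x, y⟫ = g(σ, x ∧ y)`; more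
generally `W ∈ V ⊗ V` is the endomorphism with `⟪W x, y⟫ = g(W, x ⊗ y)`. -/

namespace IrredSO3

section LinearAlgebra

variable {V : Type*} [NormedAddCommGroup V] [InnerProductSpace ℝ V]

/-- A trilinear form on `V`. -/
abbrev Trilinear (V : Type*) [NormedAddCommGroup V] [InnerProductSpace ℝ V] : Type _ :=
  V →ₗ[ℝ] V →ₗ[ℝ] V →ₗ[ℝ] ℝ

/-- Total symmetry of a trilinear form. -/
def IsSymm (Υ : Trilinear V) : Prop :=
  (∀ u v w, Υ u v w = Υ v u w) ∧ (∀ u v w, Υ u v w = Υ u w v)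

/-- The `SO(3)`-invariant cubic `(3√3/2) det μ(x)` on `ℝ⁵`, where `μ(x)` is the symmetric
traceless matrix
`[[x₁/√3 - x₄, x₂, x₃], [x₂, x₁/√3 + x₄, x₅], [x₃, x₅, -2x₁/√3]]`.
The coordinates `x₁, …, x₅` are `x 0, …, x 4`. -/
def cubic (x : Fin 5 → ℝ) : ℝ :=
  1 / 2 * x 0 * (6 * x 1 ^ 2 + 6 * x 3 ^ 2 - 2 * x 0 ^ 2 - 3 * x 2 ^ 2 - 3 * x 4 ^ 2)
    + 3 * √3 / 2 * x 3 * (x 4 ^ 2 - x 2 ^ 2) + 3 * √3 * x 1 * x 2 * x 4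

/-- An orthonormal basis `a` is adapted to the orientation `o` and the form `Υ` if it is positively
oriented and `Υ(x, x, x)` is the standard cubic in the coordinates with respect to `a`. -/
def IsAdapted (o : Orientation ℝ V (Fin 5)) (Υ : Trilinear V)
    (a : OrthonormalBasis (Fin 5) ℝ V) : Prop :=
  a.toBasis.orientation = o ∧
    ∀ x : Fin 5 → ℝ,
      Υ (∑ i, x i • a i) (∑ i, x i • a i) (∑ i, x i • a i) = cubic x

variable [Fact (finrank ℝ V = 5)]

/-- A 5-dimensional space is finite dimensional. -/
theorem finite_of_fact (V : Type*) [NormedAddCommGroup V] [InnerProductSpace ℝ V]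
    [h : Fact (finrank ℝ V = 5)] : FiniteDimensional ℝ V :=
  Module.finite_of_finrank_pos (by rw [h.out]; norm_num)

/-- Some orthonormal basis `e₁, …, e₅` of `V`; what is defined with it below does not depend on
the choice. -/
def onb (V : Type*) [NormedAddCommGroup V] [InnerProductSpace ℝ V]
    [h : Fact (finrank ℝ V = 5)] : OrthonormalBasis (Fin 5) ℝ V :=
  haveI := finite_of_fact V
  (stdOrthonormalBasis ℝ V).reindex (finCongr h.out)

/-- The endomorphism `Υ_v` with `⟪Υ_v x, y⟫ = Υ(v, x, y)`, applied to `x`. -/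
def upsilonMap (Υ : Trilinear V) (v x : V) : V :=
  ∑ k, Υ v x (onb V k) • onb V k

/-- `Υ̂(W)(x) = 4 ∑ⱼ Υ_{W(eⱼ)} (Υ_{eⱼ} x)`. -/
def hatUpsilon (Υ : Trilinear V) (W : V →L[ℝ] V) (x : V) : V :=
  (4 : ℝ) • ∑ j, upsilonMap Υ (W (onb V j)) (upsilonMap Υ (onb V j) x)

/-- `Λ²₃V = {F ∈ V ⊗ V : Υ̂(F) = 7F}`, a 3-dimensional space of 2-vectors. -/
def IsLambda23 (Υ : Trilinear V) (F : V →L[ℝ] V) : Prop :=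
  ∀ x, hatUpsilon Υ F x = (7 : ℝ) • F x

/-- The metric of `Λ²V`, `g(x ∧ y, u ∧ v) = ⟪x,u⟫⟪y,v⟫ - ⟪x,v⟫⟪y,u⟫`, on the endomorphisms
representing 2-vectors: `g(σ, τ) = ½ ∑ⱼ ⟪σ eⱼ, τ eⱼ⟫`. -/
def innerTwo (σ τ : V →L[ℝ] V) : ℝ :=
  1 / 2 * ∑ j, inner ℝ (σ (onb V j)) (τ (onb V j))

/-- `ξ_σ = ¼ ⋆(σ ∧ σ)`. With `σ = ½ ∑ σᵢⱼ eᵢ ∧ eⱼ`, `σᵢⱼ = ⟪σ eᵢ, eⱼ⟫`, one has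
`⟪⋆(σ ∧ σ), eₖ⟫ vol = σ ∧ σ ∧ eₖ = ¼ ∑ σᵢⱼ σₗₘ eᵢ ∧ eⱼ ∧ eₗ ∧ eₘ ∧ eₖ`. -/
def xi (o : Orientation ℝ V (Fin 5)) (σ : V →L[ℝ] V) : V :=
  ∑ k, ((1 / 16 : ℝ) * ∑ i, ∑ j, ∑ l, ∑ m,
    inner ℝ (σ (onb V i)) (onb V j) * inner ℝ (σ (onb V l)) (onb V m) *
      o.volumeForm ![onb V i, onb V j, onb V l, onb V m, onb V k]) • onb V k

end LinearAlgebra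

/-! ## The manifold, its `SO(3)`-structure and `SO(3)`-connections -/

/-- The model space `ℝ⁵`. -/
abbrev R5 : Type := EuclideanSpace ℝ (Fin 5)

/-- The fibre `End(T_x M)` of the endomorphism bundle. -/
abbrev EndFiber (M : Type*) [TopologicalSpace M] [ChartedSpace R5 M] (x : M) : Type :=
  TangentSpace 𝓘(ℝ, R5) x →L[ℝ] TangentSpace 𝓘(ℝ, R5) x

/-- The total space of the endomorphism bundle `End(TM)`, a smooth manifold which contains the
bundle `Λ²TM` of 2-vectors as the skew-symmetric endomorphisms. -/
abbrev EndBundle (M : Type*) [TopologicalSpace M] [ChartedSpace R5 M] : Type _ :=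
  TotalSpace (R5 →L[ℝ] R5) (EndFiber M)

/-- The model with corners of the manifold `End(TM)`. -/
abbrev IEnd : ModelWithCorners ℝ (R5 × (R5 →L[ℝ] R5)) (ModelProd R5 (R5 →L[ℝ] R5)) :=
  𝓘(ℝ, R5).prod 𝓘(ℝ, R5 →L[ℝ] R5)

section Manifold

variable {M : Type*} [TopologicalSpace M] [ChartedSpace R5 M]

section Connection

variable [IsManifold 𝓘(ℝ, R5) ∞ M]

/-- An affine connection on `M`; `∇ Y x v` is `∇_v Y` at `x`. -/
abbrev Connection (M : Type*) [TopologicalSpace M] [ChartedSpace R5 M]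
    [IsManifold 𝓘(ℝ, R5) ∞ M] : Type _ :=
  CovariantDerivative 𝓘(ℝ, R5) R5 (TangentSpace 𝓘(ℝ, R5) : M → Type _)

/-- Tensoriality in `Y` of `Y ↦ ∇_v (s Y) - s (∇_v Y)` for a section `s` of `End(TM)`. -/
theorem tensorialAt_covEnd (D : Connection M) (s : Π x : M, EndFiber M x) {x : M}
    (hs : MDifferentiableAt 𝓘(ℝ, R5) IEnd (fun y ↦ (⟨y, s y⟩ : EndBundle M)) x)
    (v : TangentSpace 𝓘(ℝ, R5) x) :
    TensorialAt 𝓘(ℝ, R5) R5 (V := (TangentSpace 𝓘(ℝ, R5) : M → Type _))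
      (fun Y : Π y : M, TangentSpace 𝓘(ℝ, R5) y ↦
        D (fun y ↦ s y (Y y)) x v - s x (D Y x v)) x := by
  have hD := D.isCovariantDerivativeOn (s := univ)
  have hsY : ∀ {Y : Π y : M, TangentSpace 𝓘(ℝ, R5) y},
      MDifferentiableAt 𝓘(ℝ, R5) (𝓘(ℝ, R5).prod 𝓘(ℝ, R5))
        (fun y ↦ (⟨y, Y y⟩ : TangentBundle 𝓘(ℝ, R5) M)) x →
      MDifferentiableAt 𝓘(ℝ, R5) (𝓘(ℝ, R5).prod 𝓘(ℝ, R5))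
        (fun y ↦ (⟨y, s y (Y y)⟩ : TangentBundle 𝓘(ℝ, R5) M)) x :=
    fun hY ↦ hs.clm_bundle_apply hY
  constructor
  · intro f Y hf hY
    have h1 := congrArg (fun L ↦ L v) (hD.leibniz (hsY hY) hf)
    have h2 := congrArg (fun L ↦ L v) (hD.leibniz hY hf)
    have h3 : (fun y ↦ s y ((f • Y) y)) = f • fun y ↦ s y (Y y) := by
      ext1 y; simp
    simp only [smul_apply, add_apply, ContinuousLinearMap.smulRight_apply] at h1 h2 ⊢
    rw [h3, h1, h2, map_add, map_smul, map_smul]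
    module
  · intro Y Y' hY hY'
    have h1 := congrArg (fun L ↦ L v) (hD.add (hsY hY) (hsY hY'))
    have h2 := congrArg (fun L ↦ L v) (hD.add hY hY')
    have h3 : (fun y ↦ s y ((Y + Y') y)) = (fun y ↦ s y (Y y)) + fun y ↦ s y (Y' y) := by
      ext1 y; simp
    simp only [add_apply] at h1 h2 ⊢
    rw [h3, h1, h2, map_add]
    module

/-- The covariant derivative `∇_v s ∈ End(T_x M)` of a section `s` of `End(TM)`, given by
`(∇_v s) Y = ∇_v (s Y) - s (∇_v Y)`. -/
def covEnd (D : Connection M) (s : Π x : M, EndFiber M x) {x : M}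
    (hs : MDifferentiableAt 𝓘(ℝ, R5) IEnd (fun y ↦ (⟨y, s y⟩ : EndBundle M)) x)
    (v : TangentSpace 𝓘(ℝ, R5) x) : EndFiber M x :=
  TensorialAt.mkHom _ x (tensorialAt_covEnd D s hs v)

/-- A section of `End(TM)` near `p.1` through the point `p`, with constant components in the
preferred trivialization at `p.1`. -/
def constSection (p : EndBundle M) : Π x : M, EndFiber M x :=
  FiberBundle.extend (R5 →L[ℝ] R5) p.2

/-- The section `constSection p` is differentiable at the base point. -/
theorem mdifferentiableAt_constSection (p : EndBundle M) :
    MDifferentiableAt 𝓘(ℝ, R5) IEnd (fun y ↦ (⟨y, constSection p y⟩ : EndBundle M)) p.1 :=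
  FiberBundle.mdifferentiableAt_extend 𝓘(ℝ, R5) (R5 →L[ℝ] R5) p.2

/-- The connection term `(∇_v s)(x) ∈ End(T_x M)` at `x = p.1` for `s = constSection p`. -/
def connectionTerm (D : Connection M) (p : EndBundle M) (v : TangentSpace 𝓘(ℝ, R5) p.1) :
    EndFiber M p.1 :=
  covEnd D (constSection p) (mdifferentiableAt_constSection p) v

/-- The differential of the projection `π : End(TM) → M`. -/
def dproj (p : EndBundle M) (A : TangentSpace IEnd p) : TangentSpace 𝓘(ℝ, R5) p.1 :=
  mfderiv IEnd 𝓘(ℝ, R5) (fun q : EndBundle M ↦ q.1) p A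

/-- The vertical part (with respect to `∇`) of a tangent vector `A` to `End(TM)` at `p`, as an
element of the fibre `End(T_{π(p)} M)`: derivative of the components in the preferred
trivialization plus the connection term. If `A` is the velocity of a curve `σ(u)` then this is
the covariant derivative of `σ(u)` along the projected curve. The horizontal space of `∇` at `p` is
`{A : vertPart D p A = 0}`. -/
def vertPart (D : Connection M) (p : EndBundle M) (A : TangentSpace IEnd p) : EndFiber M p.1 :=
  (trivializationAt (R5 →L[ℝ] R5) (EndFiber M) p.1).symm p.1
      (mfderiv IEnd 𝓘(ℝ, R5 →L[ℝ] R5)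
        (fun q : EndBundle M ↦ (trivializationAt (R5 →L[ℝ] R5) (EndFiber M) p.1 q).2) p A)
    + connectionTerm D p (dproj p A)

/-- The vertical tangent vector at `p` determined by an element of the fibre: the velocity at
`r = 0` of `r ↦ p + r B`. -/
def vertLift (p : EndBundle M) (B : EndFiber M p.1) : TangentSpace IEnd p :=
  mfderiv 𝓘(ℝ, ℝ) IEnd (fun r : ℝ ↦ (⟨p.1, p.2 + r • B⟩ : EndBundle M)) 0 (1 : ℝ)

/-- The image `ds(X)` of `X ∈ T_{π(p)} M` under the differential of the section
`s = constSection p`. -/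
def sectionLift (p : EndBundle M) (X : TangentSpace 𝓘(ℝ, R5) p.1) : TangentSpace IEnd p :=
  mfderiv 𝓘(ℝ, R5) IEnd (fun y ↦ (⟨y, constSection p y⟩ : EndBundle M)) p.1 X

/-- The horizontal lift `X^h_p` of `X ∈ T_{π(p)} M` with respect to `∇`:
`X^h_p = ds(X) - (∇_X s)^{vert}` for a section `s` with `s(π(p)) = p`. -/
def horLift (D : Connection M) (p : EndBundle M) (X : TangentSpace 𝓘(ℝ, R5) p.1) :
    TangentSpace IEnd p :=
  sectionLift p X - vertLift p (connectionTerm D p X)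

end Connection

/-- Tangent spaces of `M` are 5-dimensional. -/
instance fact_finrank_tangentSpace (x : M) :
    Fact (finrank ℝ (TangentSpace 𝓘(ℝ, R5) x) = 5) :=
  ⟨finrank_euclideanSpace_fin⟩

section Structure

variable [IsManifold 𝓘(ℝ, R5) ∞ M]
  [RiemannianBundle (fun x : M ↦ TangentSpace 𝓘(ℝ, R5) x)]

/-- An irreducible `SO(3)`-structure on a Riemannian 5-manifold: an orientation and a symmetric
rank 3 tensor `Υ` such that `M` is covered by the domains of smooth frames adapted to them.
The adapted bases form a reduction of the frame bundle to `SO(3) ⊂ SO(5)`. -/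
structure IrreducibleSO3Structure (M : Type*) [TopologicalSpace M] [ChartedSpace R5 M]
    [IsManifold 𝓘(ℝ, R5) ∞ M] [RiemannianBundle (fun x : M ↦ TangentSpace 𝓘(ℝ, R5) x)] where
  /-- The orientation of the tangent spaces. -/
  orientation : ∀ x : M, Orientation ℝ (TangentSpace 𝓘(ℝ, R5) x) (Fin 5)
  /-- The tensor `Υ`. -/
  upsilon : ∀ x : M, Trilinear (TangentSpace 𝓘(ℝ, R5) x)
  symm : ∀ x, IsSymm (upsilon x)
  exists_adapted_frame : ∀ x₀ : M, ∃ U : Set M, IsOpen U ∧ x₀ ∈ U ∧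
    ∃ E : ∀ x : M, OrthonormalBasis (Fin 5) ℝ (TangentSpace 𝓘(ℝ, R5) x),
      (∀ i, ContMDiffOn 𝓘(ℝ, R5) (𝓘(ℝ, R5).prod 𝓘(ℝ, R5)) ∞
        (fun x ↦ (⟨x, E x i⟩ : TangentBundle 𝓘(ℝ, R5) M)) U) ∧
      ∀ x ∈ U, IsAdapted (orientation x) (upsilon x) (E x)

/-- `∇` preserves the tensor `Υ`: `v(Υ(X,Y,Z)) = Υ(∇_v X,Y,Z) + Υ(X,∇_v Y,Z) + Υ(X,Y,∇_v Z)`. -/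
def PreservesUpsilon (S : IrreducibleSO3Structure M) (D : Connection M) : Prop :=
  ∀ (x : M) (v : TangentSpace 𝓘(ℝ, R5) x) (X Y Z : Π y : M, TangentSpace 𝓘(ℝ, R5) y),
    MDifferentiableAt 𝓘(ℝ, R5) (𝓘(ℝ, R5).prod 𝓘(ℝ, R5))
      (fun y ↦ (⟨y, X y⟩ : TangentBundle 𝓘(ℝ, R5) M)) x →
    MDifferentiableAt 𝓘(ℝ, R5) (𝓘(ℝ, R5).prod 𝓘(ℝ, R5))
      (fun y ↦ (⟨y, Y y⟩ : TangentBundle 𝓘(ℝ, R5) M)) x →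
    MDifferentiableAt 𝓘(ℝ, R5) (𝓘(ℝ, R5).prod 𝓘(ℝ, R5))
      (fun y ↦ (⟨y, Z y⟩ : TangentBundle 𝓘(ℝ, R5) M)) x →
    (mfderiv 𝓘(ℝ, R5) 𝓘(ℝ, ℝ) (fun y ↦ S.upsilon y (X y) (Y y) (Z y)) x v : ℝ) =
      S.upsilon x (D X x v) (Y x) (Z x) + S.upsilon x (X x) (D Y x v) (Z x)
        + S.upsilon x (X x) (Y x) (D Z x v)

/-- A smooth `SO(3)`-connection: a smooth connection with `∇g = 0` and `∇Υ = 0`, i.e. one that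
comes from a connection on the bundle of adapted bases. -/
structure IsSO3Connection [IsContMDiffRiemannianBundle 𝓘(ℝ, R5) ∞ R5
      (fun x : M ↦ TangentSpace 𝓘(ℝ, R5) x)]
    (S : IrreducibleSO3Structure M) (D : Connection M) : Prop where
  smooth : CovariantDerivative.ContMDiffCovariantDerivative D ∞
  metric :
    haveI : IsContMDiffRiemannianBundle 𝓘(ℝ, R5) 1 R5 (fun x : M ↦ TangentSpace 𝓘(ℝ, R5) x) :=
      IsContMDiffRiemannianBundle.of_le (n := ∞) (by norm_cast)
    CovariantDerivative.IsMetricCompatible (V := fun x : M ↦ TangentSpace 𝓘(ℝ, R5) x) D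
  upsilon : PreservesUpsilon S D

/-- The torsion `T(X,Y) = ∇_X Y - ∇_Y X - [X,Y]` is totally skew-symmetric:
`g(T(X,Y),Z)` changes sign under the exchange of `Y` and `Z` (it always does under the exchange of
`X` and `Y`). -/
def HasSkewTorsion (D : Connection M) : Prop :=
  ∀ (x : M) (X Y Z : TangentSpace 𝓘(ℝ, R5) x),
    inner ℝ (D.torsion x X Y) Z = - inner ℝ (D.torsion x X Z) Y

/-! ## The twistor space -/

/-- The twistor space `𝕋 = {σ ∈ Λ²₃TM : |σ|² = 5}`, an embedded 7-dimensional submanifold of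
`End(TM)` and a 2-sphere bundle over `M`. -/
def twistorSpace (S : IrreducibleSO3Structure M) : Set (EndBundle M) :=
  {p | IsLambda23 (S.upsilon p.1) p.2 ∧ innerTwo p.2 p.2 = 5}

/-- The characteristic vector field `χ_σ = (ξ_σ)^h_σ`. It is tangent to the twistor space at the
points of the twistor space. -/
def chi (S : IrreducibleSO3Structure M) (D : Connection M) (p : EndBundle M) :
    TangentSpace IEnd p :=
  horLift D p (xi (S.orientation p.1) p.2)

/-- The metric `h_t(X^h + V, Y^h + W) = g(X, Y) + t g(V, W)`. -/
def hMetric (D : Connection M) (t : ℝ) (p : EndBundle M) (A B : TangentSpace IEnd p) : ℝ :=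
  inner ℝ (dproj p A) (dproj p B) + t * innerTwo (vertPart D p A) (vertPart D p B)

end Structure

/-! ## Geodesics of a submanifold of `End(TM)` with respect to a metric -/

section Geodesic

variable [IsManifold 𝓘(ℝ, R5) ∞ M]

/-- The coordinate space `ℝ⁷`. -/
abbrev R7 : Type := EuclideanSpace ℝ (Fin 7)

/-- A local coordinate system of the 7-dimensional embedded submanifold `N`: a homeomorphism `φ` of
an open subset of `N` onto an open subset of `ℝ⁷` whose inverse is a smooth immersion into the
ambient manifold. -/
structure IsCoordinateSystem (N : Set (EndBundle M)) (φ : OpenPartialHomeomorph N R7) : Prop where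
  smooth : ContMDiffOn 𝓘(ℝ, R7) IEnd ∞ (fun w ↦ (φ.symm w : EndBundle M)) φ.target
  immersion : ∀ w ∈ φ.target,
    Function.Injective (mfderiv 𝓘(ℝ, R7) IEnd (fun w ↦ (φ.symm w : EndBundle M)) w)

/-- The coordinate vector field `∂ᵢ` of a coordinate system at the point with coordinates `w`. -/
def coordVector {N : Set (EndBundle M)} (φ : OpenPartialHomeomorph N R7) (i : Fin 7) (w : R7) :
    TangentSpace IEnd (φ.symm w : EndBundle M) :=
  mfderiv 𝓘(ℝ, R7) IEnd (fun w ↦ (φ.symm w : EndBundle M)) w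
    (EuclideanSpace.single i (1 : ℝ) : R7)

/-- The components `h_ij = h(∂ᵢ, ∂ⱼ)` of a metric in a coordinate system. -/
def metricCoeff (h : ∀ p : EndBundle M, TangentSpace IEnd p → TangentSpace IEnd p → ℝ)
    {N : Set (EndBundle M)} (φ : OpenPartialHomeomorph N R7) (i j : Fin 7) (w : R7) : ℝ :=
  h (φ.symm w) (coordVector φ i w) (coordVector φ j w)

/-- The partial derivative `∂ₖ f`. -/
def partialDeriv (k : Fin 7) (f : R7 → ℝ) (w : R7) : ℝ :=
  fderiv ℝ f w (EuclideanSpace.single k (1 : ℝ))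

/-- The Christoffel symbols `Γ_{ij,l} = h(D_{∂ᵢ} ∂ⱼ, ∂ₗ) = ½ (∂ᵢ h_jl + ∂ⱼ h_il - ∂ₗ h_ij)` of the
Levi-Civita connection of `h`. -/
def christoffel (h : ∀ p : EndBundle M, TangentSpace IEnd p → TangentSpace IEnd p → ℝ)
    {N : Set (EndBundle M)} (φ : OpenPartialHomeomorph N R7) (i j l : Fin 7) (w : R7) : ℝ :=
  1 / 2 * (partialDeriv i (metricCoeff h φ j l) w + partialDeriv j (metricCoeff h φ i l) w
    - partialDeriv l (metricCoeff h φ i j) w)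

/-- `γ` is on `J` a geodesic of the submanifold `N` with the metric `h`: in every local coordinate
system the coordinates `c` of `γ` are `C²` and satisfy `h(D_{γ'} γ', ∂ₗ) = 0` for all `l`, that is
`∑ₖ h_kl c''ᵏ + ∑ᵢⱼ Γ_{ij,l} c'ⁱ c'ʲ = 0`. -/
def IsGeodesicOn (h : ∀ p : EndBundle M, TangentSpace IEnd p → TangentSpace IEnd p → ℝ)
    {N : Set (EndBundle M)} (γ : ℝ → N) (J : Set ℝ) : Prop :=
  ContinuousOn γ J ∧
  ∀ φ : OpenPartialHomeomorph N R7, IsCoordinateSystem N φ →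
    ∀ u ∈ J, γ u ∈ φ.source →
      ContDiffAt ℝ 2 (fun r ↦ φ (γ r)) u ∧
      ∀ l : Fin 7,
        ∑ k, metricCoeff h φ k l (φ (γ u)) * deriv (deriv fun r ↦ φ (γ r)) u k
          + ∑ i, ∑ j, christoffel h φ i j l (φ (γ u)) *
              deriv (fun r ↦ φ (γ r)) u i * deriv (fun r ↦ φ (γ r)) u j = 0

end Geodesic

end Manifold

end IrredSO3

end

open IrredSO3

/-!
Along an integral curve `γ` of the characteristic vector field the endomorphisms `σ = γ(u)` are
parallel for the `SO(3)`-connection `∇`, because `χ` is horizontal. The vector `ξ_σ` is a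
quadratic expression in `σ` which is equivariant under `SO(5)`, so it is also parallel along the
projected curve `x = π ∘ γ` (`fderiv_xiCoord`, from `xiCoeff_infinitesimal`). As `x' = ξ_σ`, the
curve `x` is a geodesic of `∇`, and `γ` is its horizontal lift. The metric `h_t` is of
Kaluza–Klein type, and since `∇` is metric with skew-symmetric torsion, such a lift is a geodesic
of `h_t`.

The last step is made in the given coordinate system of the twistor space, whose inverse is a map
`Ψ` into `End(TM)`. With the dual coframe `θ_a` of an oriented orthonormal frame and the matrix
entries `V_ab` of the vertical part, both pulled back by `Ψ`, the metric is `∑ θ_a² + t/2 ∑ V_ab²`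
(`hMetric_mfderiv`), and `christoffel_sum_of_diagonal` expresses its geodesic equation by the
derivatives of the functions `θ_a(c')`, `V_ab(c')` along the coordinate curve `c` and the exterior
derivatives `dθ_a`, `dV_ab`. Along the curve `V_ab(c') = 0` and `θ_a(c') = ⟪ξ, E_a⟫`. Hence the
terms with `V_ab` drop out, so that the curvature of `∇` does not enter, and the terms with `θ_a`
cancel by the first structure equation `fderiv_coframe_sub` (`sum_coframe_eq_zero`).

That `c` is `C²` needs an argument, as `γ` is an integral curve in `End(TM)`: `c` is
differentiable because `Ψ` is an immersion, and then its velocity solves the overdetermined linear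
system `θ_a(c') = ⟪ξ, E_a⟫`, `V_ab(c') = 0`, whose solution is a `C¹` vector field
(`exists_field`).
-/

noncomputable section

namespace IrredSO3

/-! ### The vector `ξ_σ` in an oriented orthonormal basis -/

section InnerProduct

theorem sum_four_comm {ι R : Type*} [Fintype ι] [AddCommMonoid R] (f : ι → ι → ι → ι → R) :
    ∑ l, ∑ m, ∑ i, ∑ j, f i j l m = ∑ i, ∑ j, ∑ l, ∑ m, f i j l m := by
  calc ∑ l, ∑ m, ∑ i, ∑ j, f i j l m = ∑ l, ∑ i, ∑ j, ∑ m, f i j l m :=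
        Finset.sum_congr rfl fun l _ ↦ by
          rw [Finset.sum_comm]
          exact Finset.sum_congr rfl fun i _ ↦ Finset.sum_comm
    _ = ∑ i, ∑ j, ∑ l, ∑ m, f i j l m := by
      rw [Finset.sum_comm]
      exact Finset.sum_congr rfl fun i _ ↦ Finset.sum_comm

variable {V : Type*} [NormedAddCommGroup V] [InnerProductSpace ℝ V]

/-- The contraction of a bilinear map with the inner product does not depend on the orthonormal
basis in which it is computed. -/
theorem sum_bilin_orthonormalBasis {ι W : Type*} [Fintype ι] [AddCommGroup W] [Module ℝ W]
    (B : V →ₗ[ℝ] V →ₗ[ℝ] W) (b e : OrthonormalBasis ι ℝ V) :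
    ∑ i, B (b i) (b i) = ∑ i, B (e i) (e i) := by
  classical
  have h : ∀ i, B (b i) (b i) = ∑ p, ∑ q,
      (inner ℝ (e p) (b i) * inner ℝ (b i) (e q)) • B (e p) (e q) := by
    intro i
    conv_lhs => rw [← e.sum_repr' (b i)]
    simp only [map_sum, map_smul, LinearMap.sum_apply, LinearMap.smul_apply, Finset.smul_sum,
      smul_smul]
    rw [Finset.sum_comm]
    refine Finset.sum_congr rfl fun p _ ↦ Finset.sum_congr rfl fun q _ ↦ ?_
    rw [real_inner_comm (b i) (e q), mul_comm]
  simp_rw [h]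
  rw [Finset.sum_comm]
  refine Finset.sum_congr rfl fun p _ ↦ ?_
  rw [Finset.sum_comm]
  simp_rw [← Finset.sum_smul, b.sum_inner_mul_inner, orthonormal_iff_ite.1 e.orthonormal]
  simp

/-- An alternating form as a function of its first two arguments, with values in the alternating
forms in the remaining ones. -/
def curryTwo {n : ℕ} (f : V [⋀^Fin (n + 2)]→ₗ[ℝ] ℝ) : V →ₗ[ℝ] V →ₗ[ℝ] V [⋀^Fin n]→ₗ[ℝ] ℝ :=
  AlternatingMap.curryLeftLinearMap ∘ₗ f.curryLeft

theorem curryTwo_apply {n : ℕ} (f : V [⋀^Fin (n + 2)]→ₗ[ℝ] ℝ) (x y : V) (v : Fin n → V) :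
    curryTwo f x y v = f (Matrix.vecCons x (Matrix.vecCons y v)) := rfl

theorem sum_alternatingMap_apply {ι : Type*} [Fintype ι] {n : ℕ} (f : ι → V [⋀^Fin n]→ₗ[ℝ] ℝ)
    (v : Fin n → V) : (∑ i, f i) v = ∑ i, f i v :=
  map_sum (⟨⟨fun g : V [⋀^Fin n]→ₗ[ℝ] ℝ ↦ g v, rfl⟩, fun _ _ ↦ rfl⟩ :
    (V [⋀^Fin n]→ₗ[ℝ] ℝ) →+ ℝ) f _

variable [Fact (finrank ℝ V = 5)]

/-- `innerTwo` may be computed with the matrix entries in any orthonormal basis, not only in the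
chosen one. -/
theorem innerTwo_eq (σ τ : V →L[ℝ] V) (b : OrthonormalBasis (Fin 5) ℝ V) :
    innerTwo σ τ = 1 / 2 * ∑ i, ∑ j, inner ℝ (σ (b i)) (b j) * inner ℝ (τ (b i)) (b j) := by
  have h := sum_bilin_orthonormalBasis
    ((innerₗ V).compl₁₂ (σ : V →ₗ[ℝ] V) (τ : V →ₗ[ℝ] V)) (onb V) b
  simp only [LinearMap.compl₁₂_apply, innerₗ_apply_apply, ContinuousLinearMap.coe_coe] at h
  rw [innerTwo, h]
  congr 1
  refine Finset.sum_congr rfl fun i _ ↦ ?_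
  rw [← b.sum_inner_mul_inner]
  refine Finset.sum_congr rfl fun j _ ↦ ?_
  rw [real_inner_comm (b j) (τ (b i))]

/-- The contraction of an alternating form with the endomorphism `σ` in its first two arguments.
This writes `xi` as a double contraction of the volume form, in which no basis appears. -/
def contractTwo {n : ℕ} (σ : V →L[ℝ] V) (f : V [⋀^Fin (n + 2)]→ₗ[ℝ] ℝ) : V [⋀^Fin n]→ₗ[ℝ] ℝ :=
  ∑ i, curryTwo f (onb V i) (σ (onb V i))

theorem contractTwo_apply {n : ℕ} (σ : V →L[ℝ] V) (f : V [⋀^Fin (n + 2)]→ₗ[ℝ] ℝ)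
    (b : OrthonormalBasis (Fin 5) ℝ V) (v : Fin n → V) :
    contractTwo σ f v = ∑ i, ∑ j, inner ℝ (σ (b i)) (b j) *
      f (Matrix.vecCons (b i) (Matrix.vecCons (b j) v)) := by
  have h := sum_bilin_orthonormalBasis ((curryTwo f).compl₂ (σ : V →ₗ[ℝ] V)) (onb V) b
  simp only [LinearMap.compl₂_apply, ContinuousLinearMap.coe_coe] at h
  rw [contractTwo, h, sum_alternatingMap_apply]
  refine Finset.sum_congr rfl fun i _ ↦ ?_
  conv_lhs => rw [← b.sum_repr' (σ (b i))]
  simp only [map_sum, map_smul, sum_alternatingMap_apply, AlternatingMap.smul_apply, smul_eq_mul,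
    curryTwo_apply]
  refine Finset.sum_congr rfl fun j _ ↦ ?_
  rw [real_inner_comm]

/-- The formula defining `xi` holds in every orthonormal basis. -/
theorem xi_eq (o : Orientation ℝ V (Fin 5)) (σ : V →L[ℝ] V) (b : OrthonormalBasis (Fin 5) ℝ V) :
    xi o σ = ∑ k, ((1 / 16 : ℝ) * ∑ i, ∑ j, ∑ l, ∑ m,
      inner ℝ (σ (b i)) (b j) * inner ℝ (σ (b l)) (b m) *
        o.volumeForm ![b i, b j, b l, b m, b k]) • b k := by
  have key : ∀ (b : OrthonormalBasis (Fin 5) ℝ V) (v : V), ∑ i, ∑ j, ∑ l, ∑ m,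
      inner ℝ (σ (b i)) (b j) * inner ℝ (σ (b l)) (b m) *
        o.volumeForm ![b i, b j, b l, b m, v] =
      contractTwo σ (contractTwo σ (n := 3) o.volumeForm) ![v] := by
    intro b v
    rw [contractTwo_apply σ _ b, Finset.sum_congr rfl fun i _ ↦ Finset.sum_congr rfl fun j _ ↦
      congrArg _ (contractTwo_apply σ _ b _)]
    simp only [Finset.mul_sum]
    rw [sum_four_comm]
    refine Finset.sum_congr rfl fun i _ ↦ Finset.sum_congr rfl fun j _ ↦
      Finset.sum_congr rfl fun l _ ↦ Finset.sum_congr rfl fun m _ ↦ ?_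
    ring
  have hup : ∀ x z : V, Function.update ![x] 0 z = ![z] := fun x z ↦ by
    ext i; simp [Subsingleton.elim i 0]
  have h := sum_bilin_orthonormalBasis
    (LinearMap.mk₂ ℝ (fun x y : V ↦
     ((1 / 16 : ℝ) * contractTwo σ (contractTwo σ (n := 3) o.volumeForm) ![x]) • y)
      (fun x x' y ↦ by
        have h := (contractTwo σ (contractTwo σ (n := 3) o.volumeForm)).map_update_add ![x] 0 x x'
        simp only [hup] at h
        simp only [h, mul_add, add_smul])
      (fun c x y ↦ by
        have h := (contractTwo σ (contractTwo σ (n := 3) o.volumeForm)).map_update_smul ![x] 0 c x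
        simp only [hup] at h
        simp only [h, smul_smul, smul_eq_mul]
        congr 1
        ring) (fun x y y' ↦ smul_add _ _ _)
      (fun c x y ↦ smul_comm _ _ _)) (onb V) b
  simp only [LinearMap.mk₂_apply] at h
  simp_rw [xi, key]
  exact h

/-- The Levi-Civita symbol in dimension 5: the determinant of the matrix with columns
`e_i, e_j, e_l, e_m, e_k`. -/
def leviCivita (i j l m k : Fin 5) : ℝ :=
  (Matrix.of fun r c ↦ if r = ![i, j, l, m, k] c then (1 : ℝ) else 0).det

/-- The Levi-Civita symbol is annihilated by the action of a skew-symmetric matrix `A` on its five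
indices: the sum is `tr A` times the symbol. -/
theorem sum_leviCivita (A : Fin 5 → Fin 5 → ℝ) (hA : ∀ i j, A i j = - A j i) (i j l m k : Fin 5) :
    ∑ a, (A a i * leviCivita a j l m k + A a j * leviCivita i a l m k
      + A a l * leviCivita i j a m k + A a m * leviCivita i j l a k
      + A a k * leviCivita i j l m a) = 0 := by
  set I : Fin 5 → Fin 5 := ![i, j, l, m, k]
  set N : Matrix (Fin 5) (Fin 5) ℝ := Matrix.of fun r c ↦ if r = I c then (1 : ℝ) else 0 with hN
  set B : Matrix (Fin 5) (Fin 5) ℝ := Matrix.of A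
  have htr : B.trace = 0 := by
    refine Finset.sum_eq_zero fun a _ ↦ ?_
    have := hA a a
    simp only [Matrix.diag_apply, B, Matrix.of_apply]
    linarith
  -- The determinants with one column of `N` replaced by that of `B N` sum to
  -- `tr (B N adj N) = tr B det N`.
  have h1 : ∑ c, N.cramer ((B * N).col c) c = 0 := by
    have : ∀ c, N.cramer ((B * N).col c) c = (N.adjugate * (B * N)) c c := fun c ↦ by
      rw [Matrix.cramer_eq_adjugate_mulVec]; rfl
    simp_rw [this]
    change (N.adjugate * (B * N)).trace = 0
    rw [Matrix.trace_mul_comm, Matrix.mul_assoc, Matrix.mul_adjugate, Matrix.mul_smul,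
      Matrix.mul_one, Matrix.trace_smul, htr, smul_zero]
  have h2 : ∀ c, N.cramer ((B * N).col c) c = ∑ a, A a (I c) *
      (Matrix.of fun r d ↦ if r = Function.update I c a d then (1 : ℝ) else 0).det := by
    intro c
    have : (B * N).col c = ∑ a, A a (I c) • Pi.single a (1 : ℝ) := by
      ext r
      simp [Matrix.mul_apply, N, B, Pi.single_apply, Finset.sum_apply]
    rw [this, map_sum, Finset.sum_apply]
    refine Finset.sum_congr rfl fun a _ ↦ ?_
    rw [map_smul, Pi.smul_apply, smul_eq_mul, Matrix.cramer_apply]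
    congr 2
    ext r d
    by_cases hd : d = c
    · subst hd; simp [Pi.single_apply]
    · simp [hd, N]
  simp_rw [h2] at h1
  rw [Finset.sum_comm] at h1
  refine Eq.trans (Finset.sum_congr rfl fun a _ ↦ ?_) h1
  have h0 : Function.update I 0 a = ![a, j, l, m, k] := by ext x; fin_cases x <;> rfl
  have h1 : Function.update I 1 a = ![i, a, l, m, k] := by ext x; fin_cases x <;> rfl
  have h2 : Function.update I 2 a = ![i, j, a, m, k] := by ext x; fin_cases x <;> rfl
  have h3 : Function.update I 3 a = ![i, j, l, a, k] := by ext x; fin_cases x <;> rfl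
  have h4 : Function.update I 4 a = ![i, j, l, m, a] := by ext x; fin_cases x <;> rfl
  rw [Fin.sum_univ_five, h0, h1, h2, h3, h4]
  rfl

/-- The components of `xi o σ` in a positively oriented orthonormal basis, as quadratic polynomials
in the matrix entries `s i j = ⟪σ eᵢ, eⱼ⟫`. -/
def xiCoeff (s : Fin 5 → Fin 5 → ℝ) (k : Fin 5) : ℝ :=
  (1 / 16 : ℝ) * ∑ i, ∑ j, ∑ l, ∑ m, s i j * s l m * leviCivita i j l m k

/-- Infinitesimal `SO(5)`-equivariance of `xiCoeff`: if the entries `s` vary with velocity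
`s i c * A j c + s c j * A i c`, where `A` is skew-symmetric, then `xiCoeff s` varies with velocity
`A (xiCoeff s)`. The left-hand side is the derivative of `xiCoeff` by the product rule. -/
theorem xiCoeff_infinitesimal (A : Fin 5 → Fin 5 → ℝ) (hA : ∀ i j, A i j = - A j i)
    (s : Fin 5 → Fin 5 → ℝ) (k : Fin 5) :
    (1 / 16 : ℝ) * ∑ i, ∑ j, ∑ l, ∑ m,
      ((∑ c, (s i c * A j c + s c j * A i c)) * s l m + s i j *
       (∑ c, (s l c * A m c + s c m * A l c))) * leviCivita i j l m k =
    ∑ c, A k c * xiCoeff s c := by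
  have H : ∑ i, ∑ j, ∑ l, ∑ m, s i j * s l m *
      ∑ a, (A a i * leviCivita a j l m k + A a j * leviCivita i a l m k
      + A a l * leviCivita i j a m k + A a m * leviCivita i j l a k
      + A a k * leviCivita i j l m a) = 0 := by
    simp only [sum_leviCivita A hA, mul_zero, Finset.sum_const_zero]
  have P : ∀ F : Fin 5 → Fin 5 → Fin 5 → Fin 5 → Fin 5 → ℝ,
      ∑ i, ∑ j, ∑ l, ∑ m, ∑ c, F i j l m c =
        ∑ x : Fin 5 × Fin 5 × Fin 5 × Fin 5 × Fin 5, F x.1 x.2.1 x.2.2.1 x.2.2.2.1 x.2.2.2.2 :=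
    fun F ↦ by simp only [Fintype.sum_prod_type]
  -- renaming the summation index `c` and one of the four other indices
  have S1 : ∑ i, ∑ j, ∑ l, ∑ m, ∑ c, s c j * A i c * s l m * leviCivita i j l m k =
      ∑ i, ∑ j, ∑ l, ∑ m, ∑ c, s i j * s l m * (A c i * leviCivita c j l m k) := by
    rw [P, P]
    exact Fintype.sum_equiv ⟨fun x ↦ (x.2.2.2.2, x.2.1, x.2.2.1, x.2.2.2.1, x.1),
      fun x ↦ (x.2.2.2.2, x.2.1, x.2.2.1, x.2.2.2.1, x.1), fun _ ↦ rfl, fun _ ↦ rfl⟩ _ _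
      fun x ↦ by simp only [Equiv.coe_fn_mk]; ring
  have S2 : ∑ i, ∑ j, ∑ l, ∑ m, ∑ c, s i c * A j c * s l m * leviCivita i j l m k =
      ∑ i, ∑ j, ∑ l, ∑ m, ∑ c, s i j * s l m * (A c j * leviCivita i c l m k) := by
    rw [P, P]
    exact Fintype.sum_equiv ⟨fun x ↦ (x.1, x.2.2.2.2, x.2.2.1, x.2.2.2.1, x.2.1),
      fun x ↦ (x.1, x.2.2.2.2, x.2.2.1, x.2.2.2.1, x.2.1), fun _ ↦ rfl, fun _ ↦ rfl⟩ _ _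
      fun x ↦ by simp only [Equiv.coe_fn_mk]; ring
  have S3 : ∑ i, ∑ j, ∑ l, ∑ m, ∑ c, s i j * (s c m * A l c) * leviCivita i j l m k =
      ∑ i, ∑ j, ∑ l, ∑ m, ∑ c, s i j * s l m * (A c l * leviCivita i j c m k) := by
    rw [P, P]
    exact Fintype.sum_equiv ⟨fun x ↦ (x.1, x.2.1, x.2.2.2.2, x.2.2.2.1, x.2.2.1),
      fun x ↦ (x.1, x.2.1, x.2.2.2.2, x.2.2.2.1, x.2.2.1), fun _ ↦ rfl, fun _ ↦ rfl⟩ _ _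
      fun x ↦ by simp only [Equiv.coe_fn_mk]; ring
  have S4 : ∑ i, ∑ j, ∑ l, ∑ m, ∑ c, s i j * (s l c * A m c) * leviCivita i j l m k =
      ∑ i, ∑ j, ∑ l, ∑ m, ∑ c, s i j * s l m * (A c m * leviCivita i j l c k) := by
    rw [P, P]
    exact Fintype.sum_equiv ⟨fun x ↦ (x.1, x.2.1, x.2.2.1, x.2.2.2.2, x.2.2.2.1),
      fun x ↦ (x.1, x.2.1, x.2.2.1, x.2.2.2.2, x.2.2.2.1), fun _ ↦ rfl, fun _ ↦ rfl⟩ _ _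
      fun x ↦ by simp only [Equiv.coe_fn_mk]; ring
  have S5 : ∑ c, A k c * ∑ i, ∑ j, ∑ l, ∑ m, s i j * s l m * leviCivita i j l m c =
      - ∑ i, ∑ j, ∑ l, ∑ m, ∑ c, s i j * s l m * (A c k * leviCivita i j l m c) := by
    simp only [Finset.mul_sum, ← Finset.sum_neg_distrib]
    rw [P, P]
    exact Fintype.sum_equiv ⟨fun x ↦ (x.2.1, x.2.2.1, x.2.2.2.1, x.2.2.2.2, x.1),
      fun x ↦ (x.2.2.2.2, x.1, x.2.1, x.2.2.1, x.2.2.2.1), fun _ ↦ rfl, fun _ ↦ rfl⟩ _ _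
      fun x ↦ by simp only [Equiv.coe_fn_mk]; rw [hA k]; ring
  have T : ∑ i, ∑ j, ∑ l, ∑ m,
      ((∑ c, (s i c * A j c + s c j * A i c)) * s l m + s i j *
        (∑ c, (s l c * A m c + s c m * A l c))) * leviCivita i j l m k =
      ∑ c, A k c * ∑ i, ∑ j, ∑ l, ∑ m, s i j * s l m * leviCivita i j l m c := by
    simp only [Finset.sum_add_distrib, add_mul, mul_add, Finset.sum_mul, Finset.mul_sum] at H ⊢
    simp only [Finset.mul_sum] at S5
    rw [S1, S2, S3, S4, S5]
    linarith
  rw [T]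
  simp only [xiCoeff, Finset.mul_sum]
  refine Finset.sum_congr rfl fun c _ ↦ Finset.sum_congr rfl fun i _ ↦ Finset.sum_congr rfl
    fun j _ ↦ Finset.sum_congr rfl fun l _ ↦ Finset.sum_congr rfl fun m _ ↦ ?_
  ring

theorem xi_eq_sum_xiCoeff (o : Orientation ℝ V (Fin 5)) (σ : V →L[ℝ] V)
    (b : OrthonormalBasis (Fin 5) ℝ V) (hb : b.toBasis.orientation = o) :
    xi o σ = ∑ k, xiCoeff (fun i j ↦ inner ℝ (σ (b i)) (b j)) k • b k := by
  have h : ∀ i j l m k, o.volumeForm ![b i, b j, b l, b m, b k] = leviCivita i j l m k := by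
    intro i j l m k
    rw [o.volumeForm_robust b hb, Basis.det_apply, leviCivita]
    congr 1
    ext r c
    have : ![b i, b j, b l, b m, b k] c = b (![i, j, l, m, k] c) := by fin_cases c <;> rfl
    rw [Basis.toMatrix_apply, this, ← b.coe_toBasis, Basis.repr_self, Finsupp.single_apply,
      Matrix.of_apply]
    simp only [eq_comm]
  simp only [xi_eq o σ b, xiCoeff, h]

end InnerProduct

/-! ### Geodesic equation and regularity of curves in coordinates -/

section Coordinates

theorem R7.sum_single (v : R7) : v = ∑ i, v i • (EuclideanSpace.single i (1 : ℝ) : R7) := by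
  ext j
  simp [Pi.single_apply]

theorem sum_mul_clm_single (L : R7 →L[ℝ] ℝ) (v : R7) :
    L v = ∑ i, v i * L (EuclideanSpace.single i (1 : ℝ)) := by
  conv_lhs => rw [R7.sum_single v]
  simp only [map_sum, map_smul, smul_eq_mul]

/-- The left-hand side of the geodesic equation for a metric `∑ c_b Θ_b ⊗ Θ_b` given by 1-forms
`Θ_b`. At `w = c(u)`, `v = c'(u)`, `a = c''(u)` the first bracket is the derivative of
`r ↦ Θ_b(c'(r))` at `u`, and the last one is the exterior derivative `dΘ_b(v, eₗ)`. -/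
theorem christoffel_sum_of_diagonal {κ : Type*} [Fintype κ] (c : κ → ℝ) (Θ : κ → R7 → R7 →L[ℝ] ℝ)
    {w : R7} (hΘ : ∀ a, DifferentiableAt ℝ (Θ a) w) (h : Fin 7 → Fin 7 → R7 → ℝ)
    (hh : ∀ i j, h i j =ᶠ[𝓝 w] fun w ↦ ∑ a, c a * (Θ a w (EuclideanSpace.single i (1 : ℝ)) *
      Θ a w (EuclideanSpace.single j (1 : ℝ)))) (v a : R7) (l : Fin 7) :
    ∑ k, h k l w * a k + ∑ i, ∑ j, 1 / 2 * (partialDeriv i (h j l) w + partialDeriv j (h i l) w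
      - partialDeriv l (h i j) w) * v i * v j =
    ∑ b, c b * ((fderiv ℝ (Θ b) w v v + Θ b w a) * Θ b w (EuclideanSpace.single l (1 : ℝ)) +
      Θ b w v * (fderiv ℝ (Θ b) w v (EuclideanSpace.single l (1 : ℝ)) -
        fderiv ℝ (Θ b) w (EuclideanSpace.single l (1 : ℝ)) v)) := by
  set e : Fin 7 → R7 := fun i ↦ EuclideanSpace.single i (1 : ℝ) with he
  have hd : ∀ k i j, partialDeriv k (h i j) w = ∑ b, c b *
      (fderiv ℝ (Θ b) w (e k) (e i) * Θ b w (e j)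
        + Θ b w (e i) * fderiv ℝ (Θ b) w (e k) (e j)) := by
    intro k i j
    rw [partialDeriv, (hh i j).fderiv_eq]
    have h1 : ∀ b (x : R7),
        HasFDerivAt (fun w ↦ Θ b w x) ((fderiv ℝ (Θ b) w).flip x) w := fun b x ↦ by
      simpa using (hΘ b).hasFDerivAt.clm_apply (hasFDerivAt_const x w)
    have h2 : HasFDerivAt (fun w ↦ ∑ b, c b * (Θ b w (e i) * Θ b w (e j))) _ w :=
      HasFDerivAt.fun_sum (u := Finset.univ) fun b _ ↦
        (((h1 b (e i)).mul (h1 b (e j))).const_mul (c b))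
    rw [h2.fderiv]
    simp only [sum_apply, add_apply, smul_apply, ContinuousLinearMap.flip_apply,
      smul_eq_mul, he]
    refine Finset.sum_congr rfl fun b _ ↦ ?_
    ring
  have hD : ∀ b (x y : R7), fderiv ℝ (Θ b) w x y =
      ∑ i, ∑ j, x i * y j * fderiv ℝ (Θ b) w (e i) (e j) := by
    intro b x y
    conv_lhs => rw [R7.sum_single x]
    simp only [map_sum, map_smul, sum_apply, smul_apply, smul_eq_mul]
    refine Finset.sum_congr rfl fun i _ ↦ ?_
    rw [sum_mul_clm_single, Finset.mul_sum]
    refine Finset.sum_congr rfl fun j _ ↦ ?_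
    ring
  have hT : ∀ b (x : R7), Θ b w x = ∑ i, x i * Θ b w (e i) := fun b x ↦ sum_mul_clm_single _ x
  have s1 : ∑ k, h k l w * a k = ∑ b, c b * (Θ b w a * Θ b w (e l)) := by
    simp_rw [(hh _ _).self_of_nhds, hT _ a, Finset.sum_mul, Finset.mul_sum]
    rw [Finset.sum_comm]
    refine Finset.sum_congr rfl fun b _ ↦ Finset.sum_congr rfl fun k _ ↦ ?_
    ring
  have s2 : ∑ i, ∑ j, 1 / 2 * (partialDeriv i (h j l) w + partialDeriv j (h i l) w
      - partialDeriv l (h i j) w) * v i * v j = ∑ b, c b * ∑ i, ∑ j, 1 / 2 *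
        (fderiv ℝ (Θ b) w (e i) (e j) * Θ b w (e l) + Θ b w (e j) * fderiv ℝ (Θ b) w (e i) (e l)
        + (fderiv ℝ (Θ b) w (e j) (e i) * Θ b w (e l) + Θ b w (e i) * fderiv ℝ (Θ b) w (e j) (e l))
        - (fderiv ℝ (Θ b) w (e l) (e i) * Θ b w (e j)
          + Θ b w (e i) * fderiv ℝ (Θ b) w (e l) (e j))) * v i * v j := by
    simp_rw [hd, ← Finset.sum_add_distrib, ← Finset.sum_sub_distrib, Finset.mul_sum, Finset.sum_mul]
    refine (Finset.sum_congr rfl fun i _ ↦ Finset.sum_comm).trans (Finset.sum_comm.trans ?_)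
    refine Finset.sum_congr rfl fun b _ ↦ Finset.sum_congr rfl fun i _ ↦
      Finset.sum_congr rfl fun j _ ↦ ?_
    ring
  rw [s1, s2, ← Finset.sum_add_distrib]
  refine Finset.sum_congr rfl fun b _ ↦ ?_
  rw [← mul_add]
  congr 1
  have q1 := hD b v v
  have q2 : fderiv ℝ (Θ b) w v v = ∑ i, ∑ j, v i * v j * fderiv ℝ (Θ b) w (e j) (e i) := by
    rw [q1, Finset.sum_comm]
    refine Finset.sum_congr rfl fun i _ ↦ Finset.sum_congr rfl fun j _ ↦ ?_
    ring
  have q3 : fderiv ℝ (Θ b) w v (e l) = ∑ i, v i * fderiv ℝ (Θ b) w (e i) (e l) :=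
    sum_mul_clm_single ((fderiv ℝ (Θ b) w).flip (e l)) v
  have q4 : fderiv ℝ (Θ b) w (e l) v = ∑ i, v i * fderiv ℝ (Θ b) w (e l) (e i) :=
    sum_mul_clm_single _ v
  have p3 : Θ b w v * fderiv ℝ (Θ b) w v (e l) =
      ∑ i, ∑ j, v i * Θ b w (e i) * (v j * fderiv ℝ (Θ b) w (e j) (e l)) := by
    rw [q3, hT b v, Finset.sum_mul_sum]
  have p3' : Θ b w v * fderiv ℝ (Θ b) w v (e l) =
      ∑ i, ∑ j, v i * fderiv ℝ (Θ b) w (e i) (e l) * (v j * Θ b w (e j)) := by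
    rw [q3, hT b v, mul_comm, Finset.sum_mul_sum]
  have p4 : Θ b w v * fderiv ℝ (Θ b) w (e l) v =
      ∑ i, ∑ j, v i * Θ b w (e i) * (v j * fderiv ℝ (Θ b) w (e l) (e j)) := by
    rw [q4, hT b v, Finset.sum_mul_sum]
  have p4' : Θ b w v * fderiv ℝ (Θ b) w (e l) v =
      ∑ i, ∑ j, v i * fderiv ℝ (Θ b) w (e l) (e i) * (v j * Θ b w (e j)) := by
    rw [q4, hT b v, mul_comm, Finset.sum_mul_sum]
  have hsplit : ∑ i, ∑ j, 1 / 2 *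
        (fderiv ℝ (Θ b) w (e i) (e j) * Θ b w (e l) + Θ b w (e j) * fderiv ℝ (Θ b) w (e i) (e l)
        + (fderiv ℝ (Θ b) w (e j) (e i) * Θ b w (e l) + Θ b w (e i) * fderiv ℝ (Θ b) w (e j) (e l))
        - (fderiv ℝ (Θ b) w (e l) (e i) * Θ b w (e j)
          + Θ b w (e i) * fderiv ℝ (Θ b) w (e l) (e j))) * v i * v j =
      1 / 2 * (fderiv ℝ (Θ b) w v v * Θ b w (e l) + Θ b w v * fderiv ℝ (Θ b) w v (e l)
        + (fderiv ℝ (Θ b) w v v * Θ b w (e l) + Θ b w v * fderiv ℝ (Θ b) w v (e l))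
        - (Θ b w v * fderiv ℝ (Θ b) w (e l) v + Θ b w v * fderiv ℝ (Θ b) w (e l) v)) := by
    conv_rhs =>
      enter [2, 1, 1, 1, 1]
      rw [q1]
    conv_rhs =>
      enter [2, 1, 1, 2]
      rw [p3']
    conv_rhs =>
      enter [2, 1, 2, 1, 1]
      rw [q2]
    conv_rhs =>
      enter [2, 1, 2, 2]
      rw [p3]
    conv_rhs =>
      enter [2, 2, 1]
      rw [p4']
    conv_rhs =>
      enter [2, 2, 2]
      rw [p4]
    simp_rw [Finset.sum_mul, ← Finset.sum_add_distrib, ← Finset.sum_sub_distrib, Finset.mul_sum]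
    refine Finset.sum_congr rfl fun i _ ↦ Finset.sum_congr rfl fun j _ ↦ ?_
    ring
  rw [hsplit]
  ring

/-- Integral curves of a `C¹` vector field are `C²`. -/
theorem contDiffAt_two_of_hasDerivAt {F : Type*} [NormedAddCommGroup F] [NormedSpace ℝ F]
    {X : F → F} {c : ℝ → F} {u : ℝ} (hX : ContDiffAt ℝ 1 X (c u))
    (h : ∀ᶠ r in 𝓝 u, HasDerivAt c (X (c r)) r) : ContDiffAt ℝ 2 c u := by
  have step : ∀ n : ℕ, ContDiffAt ℝ n X (c u) → ContDiffAt ℝ n c u → ContDiffAt ℝ (n + 1) c u := by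
    intro n hn hcn
    rw [contDiffAt_succ_iff_hasFDerivAt]
    refine ⟨fun r ↦ ContinuousLinearMap.smulRight (1 : ℝ →L[ℝ] ℝ) (X (c r)),
      ⟨_, h, fun r hr ↦ HasDerivAt.hasFDerivAt hr⟩, ?_⟩
    have := hn.comp u hcn
    exact contDiffAt_const.smulRight this
  have h0 : ContDiffAt ℝ (0 : ℕ) c u := by
    rw [Nat.cast_zero, contDiffAt_zero]
    exact ⟨_, h, fun r hr ↦ (HasDerivAt.continuousAt hr).continuousWithinAt⟩
  have h1 := step 0 (hX.of_le (by simp)) h0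
  have h2 := step 1 (by simpa using hX) (by simpa using h1)
  simpa [one_add_one_eq_two] using h2

variable {F G : Type*} [NormedAddCommGroup F] [NormedSpace ℝ F] [FiniteDimensional ℝ F]
  [NormedAddCommGroup G] [NormedSpace ℝ G] [FiniteDimensional ℝ G]

omit [FiniteDimensional ℝ F] in
theorem exists_leftInverse_clm {L : F →L[ℝ] G} (hL : Function.Injective L) :
    ∃ P : G →L[ℝ] F, P ∘L L = ContinuousLinearMap.id ℝ F := by
  obtain ⟨P, hP⟩ := LinearMap.exists_leftInverse_of_injective (L : F →ₗ[ℝ] G)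
    (LinearMap.ker_eq_bot.2 hL)
  refine ⟨LinearMap.toContinuousLinearMap P, ?_⟩
  ext x
  exact congrArg (fun f ↦ f x) hP

/-- A continuous curve is differentiable if its composition with an immersion is: the immersion,
followed by a suitable linear projection, has a local inverse. -/
theorem eventually_differentiableAt_of_immersion {Q : F → G} {c : ℝ → F} {u : ℝ}
    (hQ : ContDiffAt ℝ 1 Q (c u)) (hinj : Function.Injective (fderiv ℝ Q (c u)))
    (hc : ContinuousAt c u) (hQc : ∀ᶠ r in 𝓝 u, DifferentiableAt ℝ (fun r ↦ Q (c r)) r) :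
    ∀ᶠ r in 𝓝 u, DifferentiableAt ℝ c r := by
  have : CompleteSpace F := FiniteDimensional.complete ℝ F
  obtain ⟨P, hP⟩ := exists_leftInverse_clm hinj
  have hg : ContDiffAt ℝ 1 (P ∘ Q) (c u) := P.contDiff.contDiffAt.comp _ hQ
  have hg' : HasFDerivAt (P ∘ Q)
      ((ContinuousLinearEquiv.refl ℝ F : F ≃L[ℝ] F) : F →L[ℝ] F) (c u) := by
    have h1 := P.hasFDerivAt.comp (c u) (hQ.differentiableAt (by simp)).hasFDerivAt
    rw [hP] at h1
    exact h1
  have hs := hg.hasStrictFDerivAt' hg' (by simp)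
  have hleft := hs.eventually_left_inverse
  have hG : ContDiffAt ℝ 1 (hs.localInverse _ _ _) ((P ∘ Q) (c u)) :=
    hg.to_localInverse hg' (by simp)
  have hGd : ∀ᶠ z in 𝓝 ((P ∘ Q) (c u)), DifferentiableAt ℝ (hs.localInverse _ _ _) z := by
    filter_upwards [hG.eventually (by simp)] with z hz
    exact hz.differentiableAt (by simp)
  have hcont : ContinuousAt (fun r ↦ (P ∘ Q) (c r)) u := hg.continuousAt.comp hc
  filter_upwards [hcont.eventually hGd, hQc, (hc.eventually hleft).eventually_nhds] with r h1 h2 h3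
  have h4 : DifferentiableAt ℝ (fun r ↦ hs.localInverse _ _ _ ((P ∘ Q) (c r))) r :=
    DifferentiableAt.comp (g := hs.localInverse _ _ _) r h1 (P.differentiableAt.comp r h2)
  exact h4.congr_of_eventuallyEq (h3.mono fun _ h ↦ h.symm)

/-- If `L w` is injective then the solution of the overdetermined system `L z x = r z`, where it
exists, is near `w` the value of a `C¹` vector field. -/
theorem exists_field_of_clm_injective {L : F → F →L[ℝ] G} {r : F → G} {w : F}
    (hL : ContDiffAt ℝ 1 L w) (hr : ContDiffAt ℝ 1 r w) (hinj : Function.Injective (L w)) :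
    ∃ X : F → F, ContDiffAt ℝ 1 X w ∧ ∀ᶠ z in 𝓝 w, ∀ x, L z x = r z → x = X z := by
  have : CompleteSpace F := FiniteDimensional.complete ℝ F
  obtain ⟨P, hP⟩ := exists_leftInverse_clm hinj
  have hA : ContDiffAt ℝ 1 (fun z ↦ P ∘L L z) w := contDiffAt_const.clm_comp hL
  have hw : P ∘L L w = ((1 : (F →L[ℝ] F)ˣ) : F →L[ℝ] F) := hP
  have hinv : ContDiffAt ℝ 1 (fun z ↦ Ring.inverse (P ∘L L z)) w := by
    refine ContDiffAt.comp (g := Ring.inverse) w ?_ hA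
    rw [hw]
    exact contDiffAt_ringInverse ℝ 1
  refine ⟨fun z ↦ Ring.inverse (P ∘L L z) (P (r z)),
    hinv.clm_apply (P.contDiff.contDiffAt.comp w hr), ?_⟩
  have hunit : ∀ᶠ z in 𝓝 w, IsUnit (P ∘L L z) :=
    hA.continuousAt.eventually (Units.isOpen.mem_nhds (by
      change IsUnit (P ∘L L w)
      rw [hw]; exact Units.isUnit _))
  filter_upwards [hunit] with z hz x hx
  rw [← hx]
  have := congrArg (fun T : F →L[ℝ] F ↦ T x) (Ring.inverse_mul_cancel _ hz)
  exact this.symm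

end Coordinates

/-! ### Horizontal and vertical vectors on the endomorphism bundle -/

section Bundle

variable {M : Type*} [TopologicalSpace M] [ChartedSpace R5 M] [IsManifold 𝓘(ℝ, R5) ∞ M]

/-- The fibre component of a point of `End(TM)` in the preferred trivialization at `x`. -/
def fibreCoord (x : M) (q : EndBundle M) : R5 →L[ℝ] R5 :=
  (trivializationAt (R5 →L[ℝ] R5) (EndFiber M) x q).2

theorem contMDiffAt_fibreCoord {x : M} {p : EndBundle M}
    (hp : p.1 ∈ (trivializationAt (R5 →L[ℝ] R5) (EndFiber M) x).baseSet) :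
    ContMDiffAt IEnd 𝓘(ℝ, R5 →L[ℝ] R5) ∞ (fibreCoord x) p := by
  set e := trivializationAt (R5 →L[ℝ] R5) (EndFiber M) x
  have h := (e.contMDiffOn (IB := 𝓘(ℝ, R5)) (n := ∞)).contMDiffAt
    (e.open_source.mem_nhds (e.mem_source.2 hp))
  exact contMDiffAt_snd.comp p h

/-- A tangent vector to `End(TM)` is zero if its base and fibre components in a trivialization
are zero. -/
theorem eq_zero_of_mfderiv_fibreCoord_eq_zero (p : EndBundle M) {A : TangentSpace IEnd p}
    (h1 : dproj p A = 0) (h2 : mfderiv IEnd 𝓘(ℝ, R5 →L[ℝ] R5) (fibreCoord p.1) p A = 0) :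
    A = 0 := by
  set e := trivializationAt (R5 →L[ℝ] R5) (EndFiber M) p.1
  have hps : p ∈ e.source := e.mem_source.2 (FiberBundle.mem_baseSet_trivializationAt' p.1)
  have he : MDifferentiableAt IEnd IEnd e p :=
    ((e.contMDiffOn (IB := 𝓘(ℝ, R5)) (n := ∞)).contMDiffAt
      (e.open_source.mem_nhds hps)).mdifferentiableAt (by simp)
  have hes : MDifferentiableAt IEnd IEnd e.toOpenPartialHomeomorph.symm (e p) :=
    ((e.contMDiffOn_symm (IB := 𝓘(ℝ, R5)) (n := ∞)).contMDiffAt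
      (e.open_target.mem_nhds (e.map_source hps))).mdifferentiableAt (by simp)
  have hfst : ∀ᶠ q in 𝓝 p, e q = (q.1, fibreCoord p.1 q) := by
    filter_upwards [e.open_source.mem_nhds hps] with q hq
    exact Prod.ext (e.coe_fst hq) rfl
  have hE : HasMFDerivAt IEnd IEnd (fun q : EndBundle M ↦ (q.1, fibreCoord p.1 q)) p
      ((mfderiv IEnd 𝓘(ℝ, R5) (fun q : EndBundle M ↦ q.1) p).prod
        (mfderiv IEnd 𝓘(ℝ, R5 →L[ℝ] R5) (fibreCoord p.1) p)) :=
    HasMFDerivAt.prodMk (mdifferentiableAt_proj (EndFiber M)).hasMFDerivAt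
      ((contMDiffAt_fibreCoord (FiberBundle.mem_baseSet_trivializationAt' p.1)).mdifferentiableAt
        (by simp)).hasMFDerivAt
  have hE' := hE.congr_of_eventuallyEq hfst
  have hid : HasMFDerivAt IEnd IEnd (fun q : EndBundle M ↦ q) p
      ((mfderiv IEnd IEnd e.toOpenPartialHomeomorph.symm (e p)).comp _) :=
    (hes.hasMFDerivAt.comp p hE').congr_of_eventuallyEq (by
      filter_upwards [e.open_source.mem_nhds hps] with q hq
      exact (e.left_inv hq).symm)
  have := congrArg (fun L ↦ L A) (hasMFDerivAt_unique hid (hasMFDerivAt_id p))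
  have hA : ((mfderiv IEnd 𝓘(ℝ, R5) (fun q : EndBundle M ↦ q.1) p).prod
        (mfderiv IEnd 𝓘(ℝ, R5 →L[ℝ] R5) (fibreCoord p.1) p)) A = 0 :=
    Prod.ext h1 h2
  refine this.symm.trans ?_
  refine (congrArg (mfderiv IEnd IEnd e.toOpenPartialHomeomorph.symm (e p)) hA).trans ?_
  exact ContinuousLinearMap.map_zero _

theorem dproj_sectionLift (p : EndBundle M) (X : TangentSpace 𝓘(ℝ, R5) p.1) :
    dproj p (sectionLift p X) = X := by
  -- The base point of the derivative of the section is `p` only up to a propositional equality.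
  have hp : (⟨p.1, constSection p p.1⟩ : EndBundle M) = p := by simp [constSection]
  have h := (mdifferentiableAt_constSection p).hasMFDerivAt
  have h2 : HasMFDerivAt IEnd 𝓘(ℝ, R5) (fun q : EndBundle M ↦ q.1)
      (⟨p.1, constSection p p.1⟩ : EndBundle M)
      (mfderiv IEnd 𝓘(ℝ, R5) (fun q : EndBundle M ↦ q.1) _) :=
    (mdifferentiableAt_proj (EndFiber M)).hasMFDerivAt
  have h3 := congrArg (fun L ↦ L X) (hasMFDerivAt_unique (h2.comp p.1 h) (hasMFDerivAt_id p.1))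
  refine Eq.trans ?_ h3
  unfold dproj sectionLift
  rw [hp]
  rfl

theorem fibreCoord_add_smul (p : EndBundle M) (B : EndFiber M p.1) (r : ℝ) :
    fibreCoord p.1 ⟨p.1, p.2 + r • B⟩ = fibreCoord p.1 p + r • fibreCoord p.1 ⟨p.1, B⟩ := by
  have h := (trivializationAt (R5 →L[ℝ] R5) (EndFiber M) p.1).linear ℝ
    (FiberBundle.mem_baseSet_trivializationAt' p.1)
  exact (h.map_add _ _).trans (congrArg _ (h.map_smul _ _))

theorem mdifferentiableAt_vertCurve (p : EndBundle M) (B : EndFiber M p.1) :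
    MDifferentiableAt 𝓘(ℝ, ℝ) IEnd (fun r : ℝ ↦ (⟨p.1, p.2 + r • B⟩ : EndBundle M)) 0 := by
  rw [mdifferentiableAt_totalSpace]
  refine ⟨mdifferentiableAt_const, ?_⟩
  have h : (fun r : ℝ ↦ (trivializationAt (R5 →L[ℝ] R5) (EndFiber M) p.1
      ⟨p.1, p.2 + r • B⟩).2) = fun r ↦ fibreCoord p.1 p + r • fibreCoord p.1 ⟨p.1, B⟩ :=
    funext (fibreCoord_add_smul p B)
  rw [h, mdifferentiableAt_iff_differentiableAt]
  fun_prop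

theorem dproj_vertLift (p : EndBundle M) (B : EndFiber M p.1) :
    dproj p (vertLift p B) = 0 := by
  have h := (mdifferentiableAt_vertCurve p B).hasMFDerivAt
  have hp : (⟨p.1, p.2 + (0:ℝ) • B⟩ : EndBundle M) = p := by simp
  have h2 : HasMFDerivAt IEnd 𝓘(ℝ, R5) (fun q : EndBundle M ↦ q.1)
      (⟨p.1, p.2 + (0:ℝ) • B⟩ : EndBundle M)
      (mfderiv IEnd 𝓘(ℝ, R5) (fun q : EndBundle M ↦ q.1) _) :=
    (mdifferentiableAt_proj (EndFiber M)).hasMFDerivAt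
  have h3 := congrArg (fun L ↦ L (1:ℝ)) (hasMFDerivAt_unique (h2.comp (0:ℝ) h)
    (hasMFDerivAt_const (I := 𝓘(ℝ, ℝ)) p.1 (0:ℝ)))
  refine Eq.trans ?_ h3
  unfold dproj vertLift
  rw [hp]
  rfl

theorem mfderiv_fibreCoord_sectionLift (p : EndBundle M) (X : TangentSpace 𝓘(ℝ, R5) p.1) :
    mfderiv IEnd 𝓘(ℝ, R5 →L[ℝ] R5) (fibreCoord p.1) p (sectionLift p X) = 0 := by
  have hp : (⟨p.1, constSection p p.1⟩ : EndBundle M) = p := by simp [constSection]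
  have h := (mdifferentiableAt_constSection p).hasMFDerivAt
  have h2 : HasMFDerivAt IEnd 𝓘(ℝ, R5 →L[ℝ] R5) (fibreCoord p.1)
      (⟨p.1, constSection p p.1⟩ : EndBundle M)
      (mfderiv IEnd 𝓘(ℝ, R5 →L[ℝ] R5) (fibreCoord p.1) _) := by
    rw [hp]
    exact ((contMDiffAt_fibreCoord
      (FiberBundle.mem_baseSet_trivializationAt' p.1)).mdifferentiableAt (by simp)).hasMFDerivAt
  have h4 : HasMFDerivAt 𝓘(ℝ, R5) 𝓘(ℝ, R5 →L[ℝ] R5)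
      (fibreCoord p.1 ∘ fun y ↦ (⟨y, constSection p y⟩ : EndBundle M)) p.1 0 := by
    refine (hasMFDerivAt_const (fibreCoord p.1 p) p.1).congr_of_eventuallyEq ?_
    filter_upwards [(trivializationAt (R5 →L[ℝ] R5) (EndFiber M) p.1).open_baseSet.mem_nhds
      (FiberBundle.mem_baseSet_trivializationAt' p.1)] with y hy
    simp only [Function.comp, fibreCoord, constSection, FiberBundle.extend]
    rw [(trivializationAt (R5 →L[ℝ] R5) (EndFiber M) p.1).apply_mk_symm hy]
  have h3 := congrArg (fun L ↦ L X) (hasMFDerivAt_unique (h2.comp p.1 h) h4)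
  refine Eq.trans ?_ h3
  unfold sectionLift
  rw [hp]
  rfl

theorem mfderiv_fibreCoord_vertLift (p : EndBundle M) (B : EndFiber M p.1) :
    mfderiv IEnd 𝓘(ℝ, R5 →L[ℝ] R5) (fibreCoord p.1) p (vertLift p B) =
     fibreCoord p.1 ⟨p.1, B⟩ := by
  have hp : (⟨p.1, p.2 + (0:ℝ) • B⟩ : EndBundle M) = p := by simp
  have h := (mdifferentiableAt_vertCurve p B).hasMFDerivAt
  have h2 : HasMFDerivAt IEnd 𝓘(ℝ, R5 →L[ℝ] R5) (fibreCoord p.1)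
      (⟨p.1, p.2 + (0:ℝ) • B⟩ : EndBundle M)
      (mfderiv IEnd 𝓘(ℝ, R5 →L[ℝ] R5) (fibreCoord p.1) _) := by
    rw [hp]
    exact ((contMDiffAt_fibreCoord
      (FiberBundle.mem_baseSet_trivializationAt' p.1)).mdifferentiableAt (by simp)).hasMFDerivAt
  have h5 : HasFDerivAt (fun r : ℝ ↦ fibreCoord p.1 p + r • fibreCoord p.1 ⟨p.1, B⟩)
      ((1 : ℝ →L[ℝ] ℝ).smulRight (fibreCoord p.1 ⟨p.1, B⟩)) 0 :=
    ((hasDerivAt_id (0 : ℝ)).smul_const _).const_add _ |>.hasFDerivAt.congr_fderiv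
      (by ext; simp)
  have h6 : (fibreCoord p.1 ∘ fun r : ℝ ↦ (⟨p.1, p.2 + r • B⟩ : EndBundle M)) =
        fun r ↦ fibreCoord p.1 p + r • fibreCoord p.1 ⟨p.1, B⟩ :=
      funext (fibreCoord_add_smul p B)
  have h4 := h5.hasMFDerivAt
  rw [← h6] at h4
  have h3 := congrArg (fun L ↦ L (1 : ℝ)) (hasMFDerivAt_unique (h2.comp (0 : ℝ) h) h4)
  refine Eq.trans ?_ (h3.trans ?_)
  · unfold vertLift
    rw [hp]
    rfl
  · exact one_smul ℝ (fibreCoord p.1 ⟨p.1, B⟩)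

theorem symm_fibreCoord (p : EndBundle M) (B : EndFiber M p.1) :
    (trivializationAt (R5 →L[ℝ] R5) (EndFiber M) p.1).symm p.1 (fibreCoord p.1 ⟨p.1, B⟩) = B :=
  (trivializationAt (R5 →L[ℝ] R5) (EndFiber M) p.1).symm_apply_apply_mk
    (FiberBundle.mem_baseSet_trivializationAt' p.1) B

theorem dproj_horLift (D : Connection M) (p : EndBundle M) (X : TangentSpace 𝓘(ℝ, R5) p.1) :
    dproj p (horLift D p X) = X := by
  have h : dproj p (horLift D p X) = dproj p (sectionLift p X)
      - dproj p (vertLift p (connectionTerm D p X)) := ContinuousLinearMap.map_sub _ _ _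
  rw [h, dproj_sectionLift, dproj_vertLift, sub_zero]

theorem vertPart_horLift (D : Connection M) (p : EndBundle M) (X : TangentSpace 𝓘(ℝ, R5) p.1) :
    vertPart D p (horLift D p X) = 0 := by
  have h : mfderiv IEnd 𝓘(ℝ, R5 →L[ℝ] R5) (fibreCoord p.1) p (horLift D p X) =
      fibreCoord p.1 ⟨p.1, -connectionTerm D p X⟩ := by
    refine (ContinuousLinearMap.map_sub _ _ _).trans ?_
    rw [mfderiv_fibreCoord_sectionLift, mfderiv_fibreCoord_vertLift]
    refine (zero_sub _).trans ?_
    exact (((trivializationAt (R5 →L[ℝ] R5) (EndFiber M) p.1).linear ℝ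
      (FiberBundle.mem_baseSet_trivializationAt' p.1)).map_neg _).symm
  change (trivializationAt (R5 →L[ℝ] R5) (EndFiber M) p.1).symm p.1
    (mfderiv IEnd 𝓘(ℝ, R5 →L[ℝ] R5) (fibreCoord p.1) p (horLift D p X)) + _ = 0
  rw [dproj_horLift]
  erw [h]
  rw [symm_fibreCoord, neg_add_cancel]

/-- Splitting of a tangent vector to `End(TM)` defined by the section `constSection p`, whose fibre
component is constant. -/
theorem eq_sectionLift_add_vertLift (p : EndBundle M) (A : TangentSpace IEnd p) :
    A = sectionLift p (dproj p A) + vertLift p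
      ((trivializationAt (R5 →L[ℝ] R5) (EndFiber M) p.1).symm p.1
        (mfderiv IEnd 𝓘(ℝ, R5 →L[ℝ] R5) (fibreCoord p.1) p A)) := by
  set B := (trivializationAt (R5 →L[ℝ] R5) (EndFiber M) p.1).symm p.1
        (mfderiv IEnd 𝓘(ℝ, R5 →L[ℝ] R5) (fibreCoord p.1) p A) with hB
  have hFB : fibreCoord p.1 ⟨p.1, B⟩ = mfderiv IEnd 𝓘(ℝ, R5 →L[ℝ] R5) (fibreCoord p.1) p A := by
    have := (trivializationAt (R5 →L[ℝ] R5) (EndFiber M) p.1).apply_mk_symm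
      (FiberBundle.mem_baseSet_trivializationAt' p.1)
      (mfderiv IEnd 𝓘(ℝ, R5 →L[ℝ] R5) (fibreCoord p.1) p A)
    exact congrArg Prod.snd this
  have h := eq_zero_of_mfderiv_fibreCoord_eq_zero p
    (A := A - (sectionLift p (dproj p A) + vertLift p B))
    (by
      have h1 : dproj p (A - (sectionLift p (dproj p A) + vertLift p B)) =
        dproj p A - (dproj p (sectionLift p (dproj p A)) + dproj p (vertLift p B)) :=
        (ContinuousLinearMap.map_sub _ _ _).trans
          (congrArg _ (ContinuousLinearMap.map_add _ _ _))
      rw [h1, dproj_sectionLift, dproj_vertLift]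
      simp)
    (by
      refine ((ContinuousLinearMap.map_sub _ _ _).trans
          (congrArg _ (ContinuousLinearMap.map_add _ _ _))).trans ?_
      rw [mfderiv_fibreCoord_sectionLift, mfderiv_fibreCoord_vertLift, hFB]
      simp)
  exact sub_eq_zero.1 h

theorem connectionTerm_zero (D : Connection M) (p : EndBundle M) :
    connectionTerm D p 0 = 0 := by
  ext Y
  simp [connectionTerm, covEnd, TensorialAt.mkHom_apply_eq_extend]

/-- The connection splits the tangent space into the vertical and the horizontal one. -/
theorem eq_zero_of_vertPart_eq_zero (D : Connection M) (p : EndBundle M) {A : TangentSpace IEnd p}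
    (h1 : dproj p A = 0) (h2 : vertPart D p A = 0) : A = 0 := by
  have h3 : (trivializationAt (R5 →L[ℝ] R5) (EndFiber M) p.1).symm p.1
        (mfderiv IEnd 𝓘(ℝ, R5 →L[ℝ] R5) (fibreCoord p.1) p A) = 0 := by
    rw [vertPart, h1, connectionTerm_zero, add_zero] at h2
    exact h2
  rw [eq_sectionLift_add_vertLift p A, h1, h3]
  have h4 : vertLift p (0 : EndFiber M p.1) = 0 := by
    have : (fun r : ℝ ↦ (⟨p.1, p.2 + r • (0 : EndFiber M p.1)⟩ : EndBundle M)) = fun _ ↦ p := by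
      funext r; simp
    unfold vertLift
    rw [this, mfderiv_const]
    rfl
  have h5 : sectionLift p (0 : TangentSpace 𝓘(ℝ, R5) p.1) = 0 := by
    exact (mfderiv 𝓘(ℝ, R5) IEnd (fun y ↦ (⟨y, constSection p y⟩ : EndBundle M)) p.1).map_zero
  rw [h4, h5, add_zero]

theorem covEnd_apply (D : Connection M) (s : Π x : M, EndFiber M x) {x : M}
    (hs : MDifferentiableAt 𝓘(ℝ, R5) IEnd (fun y ↦ (⟨y, s y⟩ : EndBundle M)) x)
    (v : TangentSpace 𝓘(ℝ, R5) x) {Y : Π y : M, TangentSpace 𝓘(ℝ, R5) y}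
    (hY : MDifferentiableAt 𝓘(ℝ, R5) (𝓘(ℝ, R5).prod 𝓘(ℝ, R5))
        (fun y ↦ (⟨y, Y y⟩ : TangentBundle 𝓘(ℝ, R5) M)) x) :
    covEnd D s hs v (Y x) = D (fun y ↦ s y (Y y)) x v - s x (D Y x v) :=
  TensorialAt.mkHom_apply _ hY

/-- Smoothness of a vector field on `M`. -/
abbrev IsSmoothField (Y : Π y : M, TangentSpace 𝓘(ℝ, R5) y) : Prop :=
  ContMDiff 𝓘(ℝ, R5) (𝓘(ℝ, R5).prod 𝓘(ℝ, R5)) ∞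
    (fun y ↦ (⟨y, Y y⟩ : TangentBundle 𝓘(ℝ, R5) M))

theorem IsSmoothField.mdifferentiableAt {Y : Π y : M, TangentSpace 𝓘(ℝ, R5) y}
    (hY : IsSmoothField Y) (x : M) :
    MDifferentiableAt 𝓘(ℝ, R5) (𝓘(ℝ, R5).prod 𝓘(ℝ, R5))
        (fun y ↦ (⟨y, Y y⟩ : TangentBundle 𝓘(ℝ, R5) M)) x :=
  hY.mdifferentiable (by simp) x

theorem fderiv_comp_eq_mvfderiv {F : Type*} [NormedAddCommGroup F] [NormedSpace ℝ F]
    {g : EndBundle M → ℝ} {Ψ : F → EndBundle M} {w : F}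
    (hg : MDifferentiableAt IEnd 𝓘(ℝ, ℝ) g (Ψ w))
    (hΨ : MDifferentiableAt 𝓘(ℝ, F) IEnd Ψ w) (u : F) :
    fderiv ℝ (fun z ↦ g (Ψ z)) w u = mvfderiv IEnd g (Ψ w) (mfderiv 𝓘(ℝ, F) IEnd Ψ w u) := by
  have h := (hg.hasMFDerivAt.comp w hΨ.hasMFDerivAt).hasFDerivAt
  have h2 : fderiv ℝ (fun z ↦ g (Ψ z)) w = _ :=
    HasFDerivAt.fderiv (𝕜 := ℝ) (E := F) (F := ℝ) h
  exact DFunLike.congr_fun h2 u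

theorem mvfderiv_comp_proj {g : M → ℝ} {p : EndBundle M}
    (hg : MDifferentiableAt 𝓘(ℝ, R5) 𝓘(ℝ, ℝ) g p.1) (A : TangentSpace IEnd p) :
    mvfderiv IEnd (fun q : EndBundle M ↦ g q.1) p A = mvfderiv 𝓘(ℝ, R5) g p.1 (dproj p A) := by
  have h := (hg.hasMFDerivAt.comp p (mdifferentiableAt_proj (EndFiber M)).hasMFDerivAt).mfderiv
  exact congrArg (fun L ↦ L A) h

variable [RiemannianBundle (fun x : M ↦ TangentSpace 𝓘(ℝ, R5) x)]
  [IsContMDiffRiemannianBundle 𝓘(ℝ, R5) ∞ R5 (fun x : M ↦ TangentSpace 𝓘(ℝ, R5) x)]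

/-- Metric compatibility for a single tangent vector in place of a vector field. -/
theorem IsSO3Connection.mvfderiv_inner {S : IrreducibleSO3Structure M} {D : Connection M}
    (hD : IsSO3Connection S D) {x : M} (v : TangentSpace 𝓘(ℝ, R5) x)
    {Y Z : Π y : M, TangentSpace 𝓘(ℝ, R5) y}
    (hY : MDifferentiableAt 𝓘(ℝ, R5) (𝓘(ℝ, R5).prod 𝓘(ℝ, R5))
        (fun y ↦ (⟨y, Y y⟩ : TangentBundle 𝓘(ℝ, R5) M)) x)
    (hZ : MDifferentiableAt 𝓘(ℝ, R5) (𝓘(ℝ, R5).prod 𝓘(ℝ, R5))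
        (fun y ↦ (⟨y, Z y⟩ : TangentBundle 𝓘(ℝ, R5) M)) x) :
    mvfderiv 𝓘(ℝ, R5) (fun y ↦ inner ℝ (Y y) (Z y)) x v =
      inner ℝ (D Y x v) (Z x) + inner ℝ (Y x) (D Z x v) := by
  have := IsContMDiffRiemannianBundle.of_le (IB := 𝓘(ℝ, R5)) (F := R5)
    (E := fun x : M ↦ TangentSpace 𝓘(ℝ, R5) x) (n := ∞) (n' := 1) (by norm_cast)
  have h := hD.metric.mvfderiv_inner_eq (FiberBundle.extend R5 v) hY hZ
  simp only [FiberBundle.extend_apply_self] at h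
  exact h

/-- The function `p ↦ ⟪p Y, Z⟫` on `End(TM)` determined by two vector fields on `M`. -/
def entry (Y Z : Π y : M, TangentSpace 𝓘(ℝ, R5) y) (q : EndBundle M) : ℝ :=
  inner ℝ (q.2 (Y q.1)) (Z q.1)

theorem contMDiff_entry {Y Z : Π y : M, TangentSpace 𝓘(ℝ, R5) y}
    (hY : IsSmoothField Y) (hZ : IsSmoothField Z) :
    ContMDiff IEnd 𝓘(ℝ, ℝ) ∞ (entry Y Z) := by
  have hproj : ContMDiff IEnd 𝓘(ℝ, R5) ∞ (fun q : EndBundle M ↦ q.1) :=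
    contMDiff_proj (EndFiber M)
  have h1 : ContMDiff IEnd (𝓘(ℝ, R5).prod 𝓘(ℝ, R5)) ∞
      (fun q : EndBundle M ↦ (⟨q.1, q.2 (Y q.1)⟩ : TangentBundle 𝓘(ℝ, R5) M)) :=
    ContMDiff.clm_bundle_apply (b := fun q : EndBundle M ↦ q.1) (ϕ := fun q : EndBundle M ↦ q.2)
      (v := fun q : EndBundle M ↦ Y q.1) (F₁ := R5) (F₂ := R5)
      contMDiff_id (hY.comp hproj)
  exact ContMDiff.inner_bundle (F := R5) (b := fun q : EndBundle M ↦ q.1) h1 (hZ.comp hproj)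

theorem mvfderiv_entry_vertLift {Y Z : Π y : M, TangentSpace 𝓘(ℝ, R5) y}
    (hY : IsSmoothField Y) (hZ : IsSmoothField Z) (p : EndBundle M) (B : EndFiber M p.1) :
    mvfderiv IEnd (entry Y Z) p (vertLift p B) = inner ℝ (B (Y p.1)) (Z p.1) := by
  have hp : (⟨p.1, p.2 + (0:ℝ) • B⟩ : EndBundle M) = p := by simp
  have h := (mdifferentiableAt_vertCurve p B).hasMFDerivAt
  have h2 : HasMFDerivAt IEnd 𝓘(ℝ, ℝ) (entry Y Z)
      (⟨p.1, p.2 + (0:ℝ) • B⟩ : EndBundle M) (mfderiv IEnd 𝓘(ℝ, ℝ) (entry Y Z) _) :=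
    ((contMDiff_entry hY hZ).mdifferentiable (by simp) _).hasMFDerivAt
  have h5 : HasFDerivAt (fun r : ℝ ↦ inner ℝ (p.2 (Y p.1)) (Z p.1)
      + r * inner ℝ (B (Y p.1)) (Z p.1))
      ((1 : ℝ →L[ℝ] ℝ).smulRight (inner ℝ (B (Y p.1)) (Z p.1))) 0 :=
    ((hasDerivAt_id (0 : ℝ)).mul_const _).const_add _ |>.hasFDerivAt.congr_fderiv
      (by ext; simp)
  have h6 : (entry Y Z ∘ fun r : ℝ ↦ (⟨p.1, p.2 + r • B⟩ : EndBundle M)) =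
      fun r : ℝ ↦ inner ℝ (p.2 (Y p.1)) (Z p.1) + r * inner ℝ (B (Y p.1)) (Z p.1) := by
    funext r
    simp [entry, inner_add_left, inner_smul_left]
  have h4 := h5.hasMFDerivAt
  rw [← h6] at h4
  have h3 := congrArg (fun L ↦ L (1 : ℝ)) (hasMFDerivAt_unique (h2.comp (0 : ℝ) h) h4)
  refine Eq.trans ?_ (h3.trans ?_)
  · unfold vertLift
    rw [hp]
    rfl
  · exact one_mul (inner ℝ (B (Y p.1)) (Z p.1))

theorem mvfderiv_entry_sectionLift {S : IrreducibleSO3Structure M} {D : Connection M}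
    (hD : IsSO3Connection S D) {Y Z : Π y : M, TangentSpace 𝓘(ℝ, R5) y}
    (hY : IsSmoothField Y) (hZ : IsSmoothField Z) (p : EndBundle M)
    (X : TangentSpace 𝓘(ℝ, R5) p.1) :
    mvfderiv IEnd (entry Y Z) p (sectionLift p X) =
      inner ℝ (connectionTerm D p X (Y p.1)) (Z p.1) + inner ℝ (p.2 (D Y p.1 X)) (Z p.1)
        + inner ℝ (p.2 (Y p.1)) (D Z p.1 X) := by
  have hp : (⟨p.1, constSection p p.1⟩ : EndBundle M) = p := by simp [constSection]
  have hp' : constSection p p.1 = p.2 := by simp [constSection]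
  have hYd := hY.mdifferentiable (by simp) p.1
  have hZd := hZ.mdifferentiable (by simp) p.1
  have hs := mdifferentiableAt_constSection p
  have h2 : HasMFDerivAt IEnd 𝓘(ℝ, ℝ) (entry Y Z)
      (⟨p.1, constSection p p.1⟩ : EndBundle M) (mfderiv IEnd 𝓘(ℝ, ℝ) (entry Y Z) _) :=
    ((contMDiff_entry hY hZ).mdifferentiable (by simp) _).hasMFDerivAt
  have h3 := congrArg (fun L ↦ L X) (h2.comp p.1 hs.hasMFDerivAt).mfderiv
  have h4 := hD.mvfderiv_inner X (hs.clm_bundle_apply hYd) hZd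
  rw [connectionTerm, covEnd_apply D _ _ _ hYd, inner_sub_left, hp', sub_add_cancel]
  rw [hp'] at h4
  refine Eq.trans ?_ h4
  refine Eq.trans ?_ h3.symm
  unfold sectionLift
  rw [hp]
  rfl

/-- The covariant derivative of an endomorphism field, tested against vector fields `Y` and `Z`:
`⟪(∇σ) Y, Z⟫ = d⟪σ Y, Z⟫ - ⟪σ ∇Y, Z⟫ - ⟪σ Y, ∇Z⟫`. -/
theorem inner_vertPart {S : IrreducibleSO3Structure M} {D : Connection M}
    (hD : IsSO3Connection S D) {Y Z : Π y : M, TangentSpace 𝓘(ℝ, R5) y}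
    (hY : IsSmoothField Y) (hZ : IsSmoothField Z) (p : EndBundle M) (A : TangentSpace IEnd p) :
    inner ℝ (vertPart D p A (Y p.1)) (Z p.1) = mvfderiv IEnd (entry Y Z) p A
      - inner ℝ (p.2 (D Y p.1 (dproj p A))) (Z p.1)
      - inner ℝ (p.2 (Y p.1)) (D Z p.1 (dproj p A)) := by
  set B := (trivializationAt (R5 →L[ℝ] R5) (EndFiber M) p.1).symm p.1
        (mfderiv IEnd 𝓘(ℝ, R5 →L[ℝ] R5) (fibreCoord p.1) p A) with hB
  have h1 : vertPart D p A = B + connectionTerm D p (dproj p A) := rfl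
  have h2 : mvfderiv IEnd (entry Y Z) p A = mvfderiv IEnd (entry Y Z) p (sectionLift p (dproj p A))
      + mvfderiv IEnd (entry Y Z) p (vertLift p B) :=
    (congrArg _ (eq_sectionLift_add_vertLift p A)).trans (ContinuousLinearMap.map_add _ _ _)
  rw [h1, h2, mvfderiv_entry_sectionLift hD hY hZ, mvfderiv_entry_vertLift hY hZ, add_apply,
    inner_add_left]
  ring

end Bundle

/-! ### Oriented orthonormal frames and coordinate vector fields -/

section Chart

variable {M : Type*} [TopologicalSpace M] [ChartedSpace R5 M] [IsManifold 𝓘(ℝ, R5) ∞ M]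

/-- The coordinate vector field `∂ᵢ` of the preferred chart at `x₀`. -/
def coordField (x₀ : M) (i : Fin 5) : Π y : M, TangentSpace 𝓘(ℝ, R5) y :=
  VectorField.mpullback 𝓘(ℝ, R5) 𝓘(ℝ, R5) (extChartAt 𝓘(ℝ, R5) x₀)
    (fun _ ↦ (EuclideanSpace.single i (1 : ℝ) : R5))

theorem contMDiffAt_const_field {F : Type*} [NormedAddCommGroup F] [NormedSpace ℝ F] (v z : F) :
    ContMDiffAt 𝓘(ℝ, F) (𝓘(ℝ, F).prod 𝓘(ℝ, F)) ∞ (fun y ↦ (⟨y, v⟩ : TangentBundle 𝓘(ℝ, F) F)) z :=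
  contMDiffAt_vectorSpace_iff_contDiffAt.2 contDiffAt_const

theorem mlieBracket_const_field {F : Type*} [NormedAddCommGroup F] [NormedSpace ℝ F] (v w z : F) :
    VectorField.mlieBracket 𝓘(ℝ, F) (fun _ ↦ v) (fun _ ↦ w) z = 0 := by
  refine (congrFun (VectorField.mlieBracketWithin_univ (I := 𝓘(ℝ, F)) (V := fun _ ↦ v)
    (W := fun _ ↦ w)) z).symm.trans ?_
  refine (congrFun VectorField.mlieBracketWithin_eq_lieBracketWithin z).trans ?_
  simp [VectorField.lieBracketWithin]
  rfl

theorem contMDiffAt_coordField (x₀ : M) (i : Fin 5) {y : M} (hy : y ∈ (chartAt R5 x₀).source) :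
    ContMDiffAt 𝓘(ℝ, R5) (𝓘(ℝ, R5).prod 𝓘(ℝ, R5)) ∞
    (fun y ↦ (⟨y, coordField x₀ i y⟩ : TangentBundle 𝓘(ℝ, R5) M)) y := by
  have : IsManifold 𝓘(ℝ, R5) (∞ + 1) M := by
    rw [show (∞ : ℕ∞ω) + 1 = ∞ from rfl]; infer_instance
  exact ContMDiffAt.mpullback_vectorField_preimage (n := ∞) (contMDiffAt_const_field _ _)
    (contMDiffAt_extChartAt' hy) (isInvertible_mfderiv_extChartAt (by simpa using hy)) (by simp)

theorem eq_sum_inverse_single {V : Type*} [TopologicalSpace V] [AddCommGroup V] [Module ℝ V]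
    {A : V →L[ℝ] R5} (hA : A.IsInvertible) (X : V) :
    X = ∑ i, (A X) i • A.inverse (EuclideanSpace.single i (1 : ℝ)) := by
  obtain ⟨e, rfl⟩ := hA
  have h : e X = ∑ i, (e X) i • (EuclideanSpace.single i (1 : ℝ) : R5) := by
    ext j
    simp [Pi.single_apply]
  conv_lhs => rw [← e.symm_apply_apply X, h]
  simp only [map_sum, map_smul]
  simp

theorem sum_coordField (x₀ : M) {y : M} (hy : y ∈ (chartAt R5 x₀).source)
    (X : TangentSpace 𝓘(ℝ, R5) y) :
    X = ∑ i, mvfderiv 𝓘(ℝ, R5) (fun z ↦ (extChartAt 𝓘(ℝ, R5) x₀ z : R5) i) y X •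
      coordField x₀ i y := by
  have hinv := isInvertible_mfderiv_extChartAt (I := 𝓘(ℝ, R5)) (x := x₀) (y := y)
    (by simpa using hy)
  have hd : MDifferentiableAt 𝓘(ℝ, R5) 𝓘(ℝ, R5) (extChartAt 𝓘(ℝ, R5) x₀) y :=
    mdifferentiableAt_extChartAt hy
  have h1 : ∀ i, mvfderiv 𝓘(ℝ, R5) (fun z ↦ (extChartAt 𝓘(ℝ, R5) x₀ z : R5) i) y X =
      (mvfderiv 𝓘(ℝ, R5) (extChartAt 𝓘(ℝ, R5) x₀) y X) i := by
    intro i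
    have h2 := ((EuclideanSpace.proj (𝕜 := ℝ) i).hasFDerivAt
      (x := extChartAt 𝓘(ℝ, R5) x₀ y)).hasMFDerivAt.comp y hd.hasMFDerivAt
    exact congrArg (fun L ↦ L X) h2.mfderiv
  simp_rw [h1]
  exact eq_sum_inverse_single hinv X

theorem mlieBracket_coordField (x₀ : M) (i j : Fin 5) {y : M} (hy : y ∈ (chartAt R5 x₀).source) :
    VectorField.mlieBracket 𝓘(ℝ, R5) (coordField x₀ i) (coordField x₀ j) y = 0 := by
  have : IsManifold 𝓘(ℝ, R5) (minSmoothness ℝ 2) M :=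
    IsManifold.of_le (n := ∞) (by simp; norm_cast)
  have := VectorField.mpullback_mlieBracket (I := 𝓘(ℝ, R5)) (I' := 𝓘(ℝ, R5))
    (n := minSmoothness ℝ 2)
    (f := extChartAt 𝓘(ℝ, R5) x₀) (x₀ := y)
    ((contMDiffAt_const_field (EuclideanSpace.single i (1 : ℝ) : R5) _).mdifferentiableAt (by simp))
    ((contMDiffAt_const_field (EuclideanSpace.single j (1 : ℝ) : R5) _).mdifferentiableAt (by simp))
    (contMDiffAt_extChartAt' hy) (by simp)
  refine this.symm.trans ?_
  rw [VectorField.mpullback_apply]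
  exact (congrArg _ (mlieBracket_const_field _ _ _)).trans (ContinuousLinearMap.map_zero _)

/-- A vector field that is smooth near `x₀` agrees near `x₀` with a globally smooth one. -/
theorem exists_isSmoothField_eventuallyEq [T2Space M] {x₀ : M} {U : Set M}
    (hU : IsOpen U) (hx : x₀ ∈ U) {Y : Π y : M, TangentSpace 𝓘(ℝ, R5) y}
    (hY : ContMDiffOn 𝓘(ℝ, R5) (𝓘(ℝ, R5).prod 𝓘(ℝ, R5)) ∞
      (fun y ↦ (⟨y, Y y⟩ : TangentBundle 𝓘(ℝ, R5) M)) U) :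
    ∃ Y' : Π y : M, TangentSpace 𝓘(ℝ, R5) y, IsSmoothField Y' ∧ ∀ᶠ y in 𝓝 x₀, Y' y = Y y := by
  obtain ⟨f, -, hf⟩ := (SmoothBumpFunction.nhds_basis_tsupport (I := 𝓘(ℝ, R5)) x₀).mem_iff.1
    (hU.mem_nhds hx)
  refine ⟨fun y ↦ f y • Y y, ?_, ?_⟩
  · exact ContMDiffOn.smul_section_of_tsupport (ψ := f) f.contMDiff.contMDiffOn hU hf hY
  · filter_upwards [f.eventuallyEq_one] with y hy
    rw [hy]; simp

variable [RiemannianBundle (fun x : M ↦ TangentSpace 𝓘(ℝ, R5) x)]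

/-- Local data on a neighbourhood `domain` of `x₀`: smooth vector fields `frame a` on `M` which form
a positively oriented orthonormal basis at each point of `domain`, and coordinate functions
`coord i` with coordinate vector fields `field i`. The vector fields are globally smooth, but the
other properties hold on `domain` only. -/
structure OrientedChart (S : IrreducibleSO3Structure M) (x₀ : M) where
  /-- The neighbourhood of `x₀`. -/
  domain : Set M
  isOpen_domain : IsOpen domain
  mem_domain : x₀ ∈ domain
  /-- The orthonormal frame. -/
  frame : Fin 5 → Π y : M, TangentSpace 𝓘(ℝ, R5) y
  smooth_frame : ∀ a, IsSmoothField (frame a)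
  orthonormal : ∀ y ∈ domain, ∃ b : OrthonormalBasis (Fin 5) ℝ (TangentSpace 𝓘(ℝ, R5) y),
    b.toBasis.orientation = S.orientation y ∧ ∀ a, b a = frame a y
  /-- The coordinate vector fields. -/
  field : Fin 5 → Π y : M, TangentSpace 𝓘(ℝ, R5) y
  smooth_field : ∀ i, IsSmoothField (field i)
  /-- The coordinate functions. -/
  coord : Fin 5 → M → ℝ
  smooth_coord : ∀ i, ∀ y ∈ domain, ContMDiffAt 𝓘(ℝ, R5) 𝓘(ℝ, ℝ) ∞ (coord i) y
  sum_field : ∀ y ∈ domain, ∀ X : TangentSpace 𝓘(ℝ, R5) y,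
    X = ∑ i, mvfderiv 𝓘(ℝ, R5) (coord i) y X • field i y
  mlieBracket_field : ∀ y ∈ domain, ∀ i j,
    VectorField.mlieBracket 𝓘(ℝ, R5) (field i) (field j) y = 0

/-- Every point has such local data: the frame is an adapted one, and the fields are extended by
cut-off functions. -/
theorem nonempty_orientedChart [T2Space M] (S : IrreducibleSO3Structure M) (x₀ : M) :
    Nonempty (OrientedChart S x₀) := by
  obtain ⟨U, hU, hxU, E, hE, hadapt⟩ := S.exists_adapted_frame x₀
  choose E' hE' hEE' using fun i ↦ exists_isSmoothField_eventuallyEq hU hxU (hE i)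
  have hC : ∀ i, ContMDiffOn 𝓘(ℝ, R5) (𝓘(ℝ, R5).prod 𝓘(ℝ, R5)) ∞
      (fun y ↦ (⟨y, coordField x₀ i y⟩ : TangentBundle 𝓘(ℝ, R5) M)) (chartAt R5 x₀).source :=
    fun i y hy ↦ (contMDiffAt_coordField x₀ i hy).contMDiffWithinAt
  choose C hC' hCC' using fun i ↦ exists_isSmoothField_eventuallyEq (chartAt R5 x₀).open_source
    (mem_chart_source R5 x₀) (hC i)
  have hev : ∀ᶠ y in 𝓝 x₀, y ∈ U ∧ y ∈ (chartAt R5 x₀).source ∧ (∀ i, E' i y = E y i) ∧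
      ∀ i, C i y = coordField x₀ i y :=
    Filter.Eventually.and (hU.mem_nhds hxU) <| Filter.Eventually.and
      ((chartAt R5 x₀).open_source.mem_nhds (mem_chart_source R5 x₀))
      ((Filter.eventually_all.2 hEE').and (Filter.eventually_all.2 hCC'))
  obtain ⟨W, hW, hWo, hxW⟩ := eventually_nhds_iff.1 hev
  refine ⟨⟨W, hWo, hxW, E', hE', ?_, C, hC',
    fun i y ↦ (extChartAt 𝓘(ℝ, R5) x₀ y : R5) i, ?_, ?_, ?_⟩⟩
  · intro y hy
    exact ⟨E y, (hadapt y (hW y hy).1).1, fun a ↦ ((hW y hy).2.2.1 a).symm⟩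
  · intro i y hy
    have h1 : ContMDiffAt 𝓘(ℝ, R5) 𝓘(ℝ, R5) ∞ (extChartAt 𝓘(ℝ, R5) x₀) y :=
      contMDiffAt_extChartAt' (hW y hy).2.1
    exact (EuclideanSpace.proj (𝕜 := ℝ) i).contDiff.contMDiff.contMDiffAt.comp y h1
  · intro y hy X
    simp_rw [(hW y hy).2.2.2]
    exact sum_coordField x₀ (hW y hy).2.1 X
  · intro y hy i j
    have h : ∀ k, C k =ᶠ[𝓝 y] coordField x₀ k := fun k ↦ by
      filter_upwards [hWo.mem_nhds hy] with z hz
      exact (hW z hz).2.2.2 k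
    rw [(h i).mlieBracket_vectorField_eq (h j)]
    exact mlieBracket_coordField x₀ i j (hW y hy).2.1

/-! ### Coframe, connection form and structure equation -/

variable {F : Type*} [NormedAddCommGroup F] [NormedSpace ℝ F]
variable {S : IrreducibleSO3Structure M} {x₀ : M}

/-- For skew-symmetric torsion `T(X, Y)` is orthogonal to `X`. For this reason the curves with
`∇`-parallel velocity are the geodesics of the metric. -/
theorem HasSkewTorsion.inner_torsion_self {D : Connection M} (hT : HasSkewTorsion D) {x : M}
    (X Y : TangentSpace 𝓘(ℝ, R5) x) : inner ℝ X (D.torsion x X Y) = 0 := by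
  rw [real_inner_comm, hT, D.torsion_self]
  simp

namespace OrientedChart

theorem sum_inner_mul_inner (C : OrientedChart S x₀) {y : M} (hy : y ∈ C.domain)
    (X Y : TangentSpace 𝓘(ℝ, R5) y) :
    ∑ a, inner ℝ X (C.frame a y) * inner ℝ (C.frame a y) Y = inner ℝ X Y := by
  obtain ⟨b, -, hb⟩ := C.orthonormal y hy
  simp_rw [← hb]
  exact b.sum_inner_mul_inner X Y

theorem sum_inner_smul_frame (C : OrientedChart S x₀) {y : M} (hy : y ∈ C.domain)
    (X : TangentSpace 𝓘(ℝ, R5) y) : ∑ a, inner ℝ (C.frame a y) X • C.frame a y = X := by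
  obtain ⟨b, -, hb⟩ := C.orthonormal y hy
  simp_rw [← hb]
  exact b.sum_repr' X

/-- The components `⟪E_a, ∂ᵢ⟫` of the coordinate vector fields in the orthonormal frame. -/
def frameField (C : OrientedChart S x₀) (a i : Fin 5) (y : M) : ℝ :=
  inner ℝ (C.frame a y) (C.field i y)

/-- The connection coefficients `⟪∇_{∂ᵢ} E_a, E_b⟫`. -/
def connCoeff (C : OrientedChart S x₀) (D : Connection M) (i a b : Fin 5) (y : M) : ℝ :=
  inner ℝ (D (C.frame a) y (C.field i y)) (C.frame b y)

/-- The differential of the `i`-th coordinate function, pulled back to `F` by `Ψ : F → End(TM)`. -/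
def dcoord (C : OrientedChart S x₀) (Ψ : F → EndBundle M) (i : Fin 5) : F → F →L[ℝ] ℝ :=
  fderiv ℝ (fun w ↦ C.coord i (Ψ w).1)

/-- The dual coframe `θ_a = ∑ ⟪E_a, ∂ᵢ⟫ dxᵢ`, pulled back by `Ψ`. -/
def coframe (C : OrientedChart S x₀) (Ψ : F → EndBundle M) (a : Fin 5) (w : F) : F →L[ℝ] ℝ :=
  ∑ i, C.frameField a i (Ψ w).1 • C.dcoord Ψ i w

/-- The connection form `ω_ab = ⟪∇ E_a, E_b⟫`, pulled back by `Ψ`. -/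
def connForm (C : OrientedChart S x₀) (D : Connection M) (Ψ : F → EndBundle M) (a b : Fin 5)
    (w : F) : F →L[ℝ] ℝ :=
  ∑ i, C.connCoeff D i a b (Ψ w).1 • C.dcoord Ψ i w

/-- The matrix entry `⟪σ E_a, E_b⟫` of the endomorphism `σ = Ψ(w)`. -/
def matrixEntry (C : OrientedChart S x₀) (Ψ : F → EndBundle M) (a b : Fin 5) (w : F) : ℝ :=
  entry (C.frame a) (C.frame b) (Ψ w)

/-- The matrix entries `V_ab` of the vertical part, pulled back by `Ψ`. In terms of the entries
`S_ab` of `σ = Ψ(w)` they are `dS_ab - ∑ (S_ac ω_bc + S_cb ω_ac)`, the components of the covariant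
derivative of `σ`. -/
def vertForm (C : OrientedChart S x₀) (D : Connection M) (Ψ : F → EndBundle M) (a b : Fin 5)
    (w : F) : F →L[ℝ] ℝ :=
  fderiv ℝ (C.matrixEntry Ψ a b) w
    - ∑ c, (C.matrixEntry Ψ a c w • C.connForm D Ψ b c w
      + C.matrixEntry Ψ c b w • C.connForm D Ψ a c w)

/-- `Ψ` is a smooth map from the open set `W` to the part of `End(TM)` over the domain of `C`. -/
structure Adapted (C : OrientedChart S x₀) (Ψ : F → EndBundle M) (W : Set F) : Prop where
  isOpen : IsOpen W
  smooth : ContMDiffOn 𝓘(ℝ, F) IEnd ∞ Ψ W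
  mapsTo : ∀ w ∈ W, (Ψ w).1 ∈ C.domain

/-- The component `⟪ξ_σ, E_a⟫` at `σ = Ψ(w)`. -/
def xiCoord (C : OrientedChart S x₀) (Ψ : F → EndBundle M) (a : Fin 5) (w : F) : ℝ :=
  xiCoeff (fun i j ↦ C.matrixEntry Ψ i j w) a

/-- Coordinates of the point `Ψ(w)` of `End(TM)`: the coordinates of its base point and its matrix
entries. -/
def bundleCoord (C : OrientedChart S x₀) (Ψ : F → EndBundle M) (w : F) :
    (Fin 5 → ℝ) × (Fin 5 → Fin 5 → ℝ) :=
  (fun i ↦ C.coord i (Ψ w).1, fun a b ↦ C.matrixEntry Ψ a b w)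

variable {C : OrientedChart S x₀} {D : Connection M} {Ψ : F → EndBundle M} {W : Set F}

namespace Adapted
variable (h : Adapted C Ψ W) {w : F} (hw : w ∈ W)
include h hw

theorem contMDiffAt : ContMDiffAt 𝓘(ℝ, F) IEnd ∞ Ψ w :=
  h.smooth.contMDiffAt (h.isOpen.mem_nhds hw)

theorem mdifferentiableAt : MDifferentiableAt 𝓘(ℝ, F) IEnd Ψ w :=
  (h.contMDiffAt hw).mdifferentiableAt (by simp)

theorem contDiffAt_comp_proj {g : M → ℝ} (hg : ContMDiffAt 𝓘(ℝ, R5) 𝓘(ℝ, ℝ) ∞ g (Ψ w).1) :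
    ContDiffAt ℝ ∞ (fun z ↦ g (Ψ z).1) w :=
  (hg.comp w ((contMDiff_proj (EndFiber M)).contMDiffAt.comp w (h.contMDiffAt hw))).contDiffAt

theorem fderiv_comp_proj {g : M → ℝ} (hg : ContMDiffAt 𝓘(ℝ, R5) 𝓘(ℝ, ℝ) ∞ g (Ψ w).1) (u : F) :
    fderiv ℝ (fun z ↦ g (Ψ z).1) w u =
      mvfderiv 𝓘(ℝ, R5) g (Ψ w).1 (dproj (Ψ w) (mfderiv 𝓘(ℝ, F) IEnd Ψ w u)) := by
  have hg' := hg.mdifferentiableAt (by simp)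
  rw [← mvfderiv_comp_proj hg']
  exact fderiv_comp_eq_mvfderiv (g := fun q : EndBundle M ↦ g q.1)
    (hg'.comp (Ψ w) (mdifferentiableAt_proj (EndFiber M))) (h.mdifferentiableAt hw) u

theorem dproj_mfderiv (u : F) :
    dproj (Ψ w) (mfderiv 𝓘(ℝ, F) IEnd Ψ w u) = ∑ i, C.dcoord Ψ i w u • C.field i (Ψ w).1 := by
  have h1 := C.sum_field _ (h.mapsTo w hw) (dproj (Ψ w) (mfderiv 𝓘(ℝ, F) IEnd Ψ w u))
  refine h1.trans (Finset.sum_congr rfl fun i _ ↦ ?_)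
  rw [dcoord, h.fderiv_comp_proj hw (C.smooth_coord i _ (h.mapsTo w hw))]

theorem coframe_apply (a : Fin 5) (u : F) :
    C.coframe Ψ a w u = inner ℝ (C.frame a (Ψ w).1) (dproj (Ψ w) (mfderiv 𝓘(ℝ, F) IEnd Ψ w u)) := by
  rw [h.dproj_mfderiv hw, inner_sum]
  simp only [coframe, sum_apply, smul_apply, inner_smul_right, smul_eq_mul, frameField]
  exact Finset.sum_congr rfl fun i _ ↦ mul_comm _ _

theorem connForm_apply (a b : Fin 5) (u : F) :
    C.connForm D Ψ a b w u = inner ℝ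
      (D (C.frame a) (Ψ w).1 (dproj (Ψ w) (mfderiv 𝓘(ℝ, F) IEnd Ψ w u))) (C.frame b (Ψ w).1) := by
  rw [h.dproj_mfderiv hw, map_sum, sum_inner]
  simp only [connForm, sum_apply, smul_apply, map_smul, real_inner_smul_left, smul_eq_mul,
    connCoeff]
  exact Finset.sum_congr rfl fun i _ ↦ mul_comm _ _

theorem contDiffAt_dcoord (i : Fin 5) : ContDiffAt ℝ ∞ (C.dcoord Ψ i) w :=
  (h.contDiffAt_comp_proj hw (C.smooth_coord i _ (h.mapsTo w hw))).fderiv_right (by simp)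

theorem inner_frame_xi (a : Fin 5) :
    inner ℝ (C.frame a (Ψ w).1) (xi (S.orientation (Ψ w).1) (Ψ w).2) = C.xiCoord Ψ a w := by
  obtain ⟨e, ho, he⟩ := C.orthonormal _ (h.mapsTo w hw)
  rw [xi_eq_sum_xiCoeff _ _ e ho, ← he]
  rw [e.orthonormal.inner_right_fintype]
  simp only [he]
  rfl

end Adapted

/-- The inverse of a coordinate system, restricted to the part over the domain of `C`. -/
theorem adapted_of_isCoordinateSystem {N : Set (EndBundle M)}
    {φ : OpenPartialHomeomorph N R7} (hφ : IsCoordinateSystem N φ)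
    (C : OrientedChart S x₀) :
    C.Adapted (fun w ↦ (φ.symm w : EndBundle M))
      (φ.target ∩ φ.symm ⁻¹' {p : N | (p : EndBundle M).1 ∈ C.domain}) where
  isOpen := φ.symm.continuousOn.isOpen_inter_preimage φ.open_target (C.isOpen_domain.preimage
    ((FiberBundle.continuous_proj (R5 →L[ℝ] R5) (EndFiber M)).comp continuous_subtype_val))
  smooth := hφ.smooth.mono inter_subset_left
  mapsTo _ hw := hw.2

variable [IsContMDiffRiemannianBundle 𝓘(ℝ, R5) ∞ R5 (fun x : M ↦ TangentSpace 𝓘(ℝ, R5) x)]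

theorem contMDiff_frameField (C : OrientedChart S x₀) (a i : Fin 5) :
    ContMDiff 𝓘(ℝ, R5) 𝓘(ℝ, ℝ) ∞ (C.frameField a i) :=
  ContMDiff.inner_bundle (F := R5) (b := fun y : M ↦ y) (C.smooth_frame a) (C.smooth_field i)

theorem contMDiff_connCoeff (C : OrientedChart S x₀) (hD : IsSO3Connection S D) (i a b : Fin 5) :
    ContMDiff 𝓘(ℝ, R5) 𝓘(ℝ, ℝ) ∞ (C.connCoeff D i a b) := by
  have h1 := hD.smooth.contMDiff.contMDiff (σ := C.frame a) (C.smooth_frame a).contMDiffOn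
  rw [contMDiffOn_univ] at h1
  have h2 := ContMDiff.clm_bundle_apply (b := fun y : M ↦ y) (ϕ := fun y : M ↦ D (C.frame a) y)
      (v := fun y : M ↦ C.field i y) (F₁ := R5) (F₂ := R5) h1 (C.smooth_field i)
  exact ContMDiff.inner_bundle (F := R5) (b := fun y : M ↦ y) h2 (C.smooth_frame b)

namespace Adapted
variable (h : Adapted C Ψ W) {w : F} (hw : w ∈ W)
include h hw

theorem connForm_skew (hD : IsSO3Connection S D) (a b : Fin 5) (u : F) :
    C.connForm D Ψ a b w u = - C.connForm D Ψ b a w u := by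
  rw [h.connForm_apply hw, h.connForm_apply hw]
  set X := dproj (Ψ w) (mfderiv 𝓘(ℝ, F) IEnd Ψ w u)
  have h1 := hD.mvfderiv_inner X ((C.smooth_frame a).mdifferentiableAt _)
    ((C.smooth_frame b).mdifferentiableAt _)
  -- The inner products of the frame fields are constant near `Ψ w`.
  have h2 : (fun y ↦ inner ℝ (C.frame a y) (C.frame b y) : M → ℝ) =ᶠ[𝓝 (Ψ w).1]
      fun _ ↦ if a = b then 1 else 0 := by
    filter_upwards [C.isOpen_domain.mem_nhds (h.mapsTo w hw)] with y hy
    obtain ⟨e, -, he⟩ := C.orthonormal y hy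
    rw [← he, ← he, orthonormal_iff_ite.1 e.orthonormal]
  have h3 : mvfderiv 𝓘(ℝ, R5) (fun y ↦ inner ℝ (C.frame a y) (C.frame b y) : M → ℝ) (Ψ w).1 X =
      0 := by
    have := ((hasMFDerivAt_const (I := 𝓘(ℝ, R5)) (I' := 𝓘(ℝ, ℝ))
      (if a = b then (1 : ℝ) else 0) (Ψ w).1).congr_of_eventuallyEq h2).mfderiv
    exact congrArg (fun L ↦ L X) this
  have h4 := real_inner_comm (C.frame a (Ψ w).1) (D (C.frame b) (Ψ w).1 X)
  linarith

theorem contDiffAt_matrixEntry (a b : Fin 5) : ContDiffAt ℝ ∞ (C.matrixEntry Ψ a b) w :=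
  ((contMDiff_entry (C.smooth_frame a) (C.smooth_frame b)).contMDiffAt.comp w
    (h.contMDiffAt hw)).contDiffAt

/-- The covariant derivatives `∇E_a` of the frame, expressed by `ω`, turn `inner_vertPart` into the
formula for `V_ab`. -/
theorem vertForm_apply (hD : IsSO3Connection S D) (a b : Fin 5) (u : F) :
    C.vertForm D Ψ a b w u = inner ℝ (vertPart D (Ψ w) (mfderiv 𝓘(ℝ, F) IEnd Ψ w u)
      (C.frame a (Ψ w).1)) (C.frame b (Ψ w).1) := by
  have hy := h.mapsTo w hw
  rw [inner_vertPart hD (C.smooth_frame a) (C.smooth_frame b), ← fderiv_comp_eq_mvfderiv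
    ((contMDiff_entry (C.smooth_frame a) (C.smooth_frame b)).mdifferentiable (by simp) _)
    (h.mdifferentiableAt hw)]
  set X := dproj (Ψ w) (mfderiv 𝓘(ℝ, F) IEnd Ψ w u)
  have h1 : inner ℝ ((Ψ w).2 (D (C.frame a) (Ψ w).1 X)) (C.frame b (Ψ w).1) =
      ∑ c, C.matrixEntry Ψ c b w * C.connForm D Ψ a c w u := by
    conv_lhs => rw [← C.sum_inner_smul_frame hy (D (C.frame a) (Ψ w).1 X)]
    rw [map_sum, sum_inner]
    refine Finset.sum_congr rfl fun c _ ↦ ?_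
    rw [map_smul, real_inner_smul_left, h.connForm_apply hw, mul_comm,
      real_inner_comm _ (C.frame c _)]
    rfl
  have h2 : inner ℝ ((Ψ w).2 (C.frame a (Ψ w).1)) (D (C.frame b) (Ψ w).1 X) =
      ∑ c, C.matrixEntry Ψ a c w * C.connForm D Ψ b c w u := by
    rw [← C.sum_inner_mul_inner hy]
    refine Finset.sum_congr rfl fun c _ ↦ ?_
    rw [h.connForm_apply hw, real_inner_comm _ (C.frame c _)]
    rfl
  rw [h1, h2]
  simp only [vertForm, sub_apply, sum_apply, add_apply, smul_apply, smul_eq_mul,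
    Finset.sum_add_distrib]
  change fderiv ℝ (C.matrixEntry Ψ a b) w u - _ = fderiv ℝ (C.matrixEntry Ψ a b) w u - _ - _
  ring

/-- The pulled back metric is `∑ θ_a² + t/2 ∑ V_ab²`. -/
theorem hMetric_mfderiv (hD : IsSO3Connection S D) (t : ℝ) (u v : F) :
    hMetric D t (Ψ w) (mfderiv 𝓘(ℝ, F) IEnd Ψ w u) (mfderiv 𝓘(ℝ, F) IEnd Ψ w v) =
      ∑ a, C.coframe Ψ a w u * C.coframe Ψ a w v
        + t * (1 / 2 * ∑ a, ∑ b, C.vertForm D Ψ a b w u * C.vertForm D Ψ a b w v) := by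
  have hy := h.mapsTo w hw
  obtain ⟨e, -, he⟩ := C.orthonormal _ hy
  rw [hMetric, ← C.sum_inner_mul_inner hy, innerTwo_eq _ _ e]
  simp_rw [h.coframe_apply hw, h.vertForm_apply hw hD, he]
  congr 1
  exact Finset.sum_congr rfl fun a _ ↦ by rw [real_inner_comm]

/-- If `Ψ` is an immersion, the 1-forms `θ_a` and `V_ab` separate tangent vectors. -/
theorem eq_zero_of_forms_eq_zero (hD : IsSO3Connection S D)
    (hinj : Function.Injective (mfderiv 𝓘(ℝ, F) IEnd Ψ w)) {u : F}
    (h1 : ∀ a, C.coframe Ψ a w u = 0) (h2 : ∀ a b, C.vertForm D Ψ a b w u = 0) : u = 0 := by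
  have hy := h.mapsTo w hw
  obtain ⟨e, -, he⟩ := C.orthonormal _ hy
  have hp : dproj (Ψ w) (mfderiv 𝓘(ℝ, F) IEnd Ψ w u) = 0 := by
    rw [← C.sum_inner_smul_frame hy (dproj (Ψ w) (mfderiv 𝓘(ℝ, F) IEnd Ψ w u))]
    refine Finset.sum_eq_zero fun a _ ↦ ?_
    rw [← h.coframe_apply hw, h1, zero_smul]
  have hv : vertPart D (Ψ w) (mfderiv 𝓘(ℝ, F) IEnd Ψ w u) = 0 := by
    refine ContinuousLinearMap.coe_injective (e.toBasis.ext fun a ↦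
      InnerProductSpace.ext_inner_right_basis e.toBasis fun b ↦ ?_)
    have h3 := (h.vertForm_apply hw hD a b u).symm.trans (h2 a b)
    simpa [he] using h3
  have := eq_zero_of_vertPart_eq_zero D (Ψ w) hp hv
  exact hinj (this.trans (ContinuousLinearMap.map_zero _).symm)

theorem contDiffAt_coframe (a : Fin 5) : ContDiffAt ℝ ∞ (C.coframe Ψ a) w :=
  ContDiffAt.sum fun i _ ↦ (h.contDiffAt_comp_proj hw (C.contMDiff_frameField a i _)).smul
    (h.contDiffAt_dcoord hw i)

theorem contDiffAt_connForm (hD : IsSO3Connection S D) (a b : Fin 5) :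
    ContDiffAt ℝ ∞ (C.connForm D Ψ a b) w :=
  ContDiffAt.sum fun i _ ↦ (h.contDiffAt_comp_proj hw (C.contMDiff_connCoeff hD i a b _)).smul
    (h.contDiffAt_dcoord hw i)

theorem contDiffAt_vertForm (hD : IsSO3Connection S D) (a b : Fin 5) :
    ContDiffAt ℝ ∞ (C.vertForm D Ψ a b) w :=
  ((h.contDiffAt_matrixEntry hw a b).fderiv_right (by simp)).sub <| ContDiffAt.sum fun c _ ↦
    ((h.contDiffAt_matrixEntry hw a c).smul (h.contDiffAt_connForm hw hD b c)).add
      ((h.contDiffAt_matrixEntry hw c b).smul (h.contDiffAt_connForm hw hD a c))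

/-- First structure equation `dθ_a = ∑ ω_ab ∧ θ_b + ⟪E_a, T⟫`, pulled back by `Ψ`. It is derived
from `θ_a = ∑ ⟪E_a, ∂ᵢ⟫ dxᵢ` and the vanishing of the brackets `[∂ᵢ, ∂ⱼ]`. -/
theorem fderiv_coframe_sub (hD : IsSO3Connection S D) (a : Fin 5) (u v : F) :
    fderiv ℝ (C.coframe Ψ a) w u v - fderiv ℝ (C.coframe Ψ a) w v u =
      ∑ b, (C.connForm D Ψ a b w u * C.coframe Ψ b w v
        - C.connForm D Ψ a b w v * C.coframe Ψ b w u)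
      + inner ℝ (C.frame a (Ψ w).1) (D.torsion (Ψ w).1
        (dproj (Ψ w) (mfderiv 𝓘(ℝ, F) IEnd Ψ w u))
        (dproj (Ψ w) (mfderiv 𝓘(ℝ, F) IEnd Ψ w v))) := by
  have hy := h.mapsTo w hw
  set X : F → TangentSpace 𝓘(ℝ, R5) (Ψ w).1 :=
    fun u ↦ dproj (Ψ w) (mfderiv 𝓘(ℝ, F) IEnd Ψ w u)
  have hXs : ∀ u, X u = ∑ i, C.dcoord Ψ i w u • C.field i (Ψ w).1 := h.dproj_mfderiv hw
  have hE := fun a ↦ (C.smooth_frame a).mdifferentiableAt (Ψ w).1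
  have hF := fun i ↦ (C.smooth_field i).mdifferentiableAt (Ψ w).1
  have hm : ∀ i u, fderiv ℝ (fun z ↦ C.frameField a i (Ψ z).1) w u =
      inner ℝ (D (C.frame a) (Ψ w).1 (X u)) (C.field i (Ψ w).1)
        + inner ℝ (C.frame a (Ψ w).1) (D (C.field i) (Ψ w).1 (X u)) := fun i u ↦ by
    rw [h.fderiv_comp_proj hw (C.contMDiff_frameField a i _)]
    exact hD.mvfderiv_inner (X u) (hE a) (hF i)
  have hd : ∀ u v, fderiv ℝ (C.coframe Ψ a) w u v =
      ∑ i, (fderiv ℝ (fun z ↦ C.frameField a i (Ψ z).1) w u * C.dcoord Ψ i w v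
        + C.frameField a i (Ψ w).1 * fderiv ℝ (C.dcoord Ψ i) w u v) := fun u v ↦ by
    have h1 : HasFDerivAt (C.coframe Ψ a) _ w := HasFDerivAt.fun_sum (u := Finset.univ) fun i _ ↦
      (((h.contDiffAt_comp_proj hw (C.contMDiff_frameField a i _)).differentiableAt
        (by simp)).hasFDerivAt.smul
        ((h.contDiffAt_dcoord hw i).differentiableAt (by simp)).hasFDerivAt)
    rw [h1.fderiv]
    simp only [sum_apply, add_apply, smul_apply, smul_eq_mul, ContinuousLinearMap.smulRight_apply]
    exact Finset.sum_congr rfl fun i _ ↦ add_comm _ _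
  have hsymm : ∀ i u v, fderiv ℝ (C.dcoord Ψ i) w u v = fderiv ℝ (C.dcoord Ψ i) w v u := fun i u v ↦
    ((h.contDiffAt_comp_proj hw (C.smooth_coord i _ hy)).isSymmSndFDerivAt
      (by simp; norm_cast)).eq u v
  have hconn : ∀ u v,
      ∑ i, inner ℝ (D (C.frame a) (Ψ w).1 (X u)) (C.field i (Ψ w).1) * C.dcoord Ψ i w v =
      ∑ b, C.connForm D Ψ a b w u * C.coframe Ψ b w v := fun u v ↦ by
    have h1 : inner ℝ (D (C.frame a) (Ψ w).1 (X u)) (X v) =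
        ∑ i, inner ℝ (D (C.frame a) (Ψ w).1 (X u)) (C.field i (Ψ w).1) * C.dcoord Ψ i w v := by
      rw [hXs v, inner_sum]
      exact Finset.sum_congr rfl fun i _ ↦ by rw [inner_smul_right, mul_comm]
    rw [← h1, ← C.sum_inner_mul_inner hy]
    exact Finset.sum_congr rfl fun b _ ↦ by rw [h.connForm_apply hw, h.coframe_apply hw]
  have hfield : ∀ u v,
      ∑ i, inner ℝ (C.frame a (Ψ w).1) (D (C.field i) (Ψ w).1 (X u)) * C.dcoord Ψ i w v =
      ∑ i, ∑ j, C.dcoord Ψ j w u * C.dcoord Ψ i w v *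
        inner ℝ (C.frame a (Ψ w).1) (D (C.field i) (Ψ w).1 (C.field j (Ψ w).1)) := fun u v ↦ by
    refine Finset.sum_congr rfl fun i _ ↦ ?_
    rw [hXs u, map_sum, inner_sum, Finset.sum_mul]
    refine Finset.sum_congr rfl fun j _ ↦ ?_
    rw [map_smul, inner_smul_right]
    ring
  have htor : inner ℝ (C.frame a (Ψ w).1) (D.torsion (Ψ w).1 (X u) (X v)) =
      ∑ i, ∑ j, C.dcoord Ψ j w u * C.dcoord Ψ i w v *
        (inner ℝ (C.frame a (Ψ w).1) (D (C.field i) (Ψ w).1 (C.field j (Ψ w).1))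
          - inner ℝ (C.frame a (Ψ w).1) (D (C.field j) (Ψ w).1 (C.field i (Ψ w).1))) := by
    have hT : ∀ i j, D.torsion (Ψ w).1 (C.field j (Ψ w).1) (C.field i (Ψ w).1) =
        D (C.field i) (Ψ w).1 (C.field j (Ψ w).1) - D (C.field j) (Ψ w).1 (C.field i (Ψ w).1) :=
      fun i j ↦ by
        rw [D.torsion_apply (hF j) (hF i), C.mlieBracket_field _ hy, sub_zero]
    rw [hXs u, hXs v]
    simp only [map_sum, map_smul, sum_apply, smul_apply, inner_sum, inner_smul_right, hT,
      inner_sub_right]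
    refine Finset.sum_congr rfl fun i _ ↦ ?_
    rw [Finset.mul_sum]
    exact Finset.sum_congr rfl fun j _ ↦ by ring
  change _ = _ + inner ℝ (C.frame a (Ψ w).1) (D.torsion (Ψ w).1 (X u) (X v))
  have hswap : ∑ i, ∑ j, C.dcoord Ψ j w u * C.dcoord Ψ i w v *
        inner ℝ (C.frame a (Ψ w).1) (D (C.field j) (Ψ w).1 (C.field i (Ψ w).1)) =
      ∑ i, ∑ j, C.dcoord Ψ j w v * C.dcoord Ψ i w u *
        inner ℝ (C.frame a (Ψ w).1) (D (C.field i) (Ψ w).1 (C.field j (Ψ w).1)) := by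
    rw [Finset.sum_comm]
    exact Finset.sum_congr rfl fun i _ ↦ Finset.sum_congr rfl fun j _ ↦ by ring
  rw [htor, hd, hd]
  simp only [hm, add_mul, mul_sub, Finset.sum_add_distrib, Finset.sum_sub_distrib, hconn, hfield,
    hsymm _ v u, hswap]
  ring

/-! ### The characteristic vector field -/

theorem contDiffAt_bundleCoord : ContDiffAt ℝ ∞ (C.bundleCoord Ψ) w :=
  (contDiffAt_pi.2 fun i ↦ h.contDiffAt_comp_proj hw (C.smooth_coord i _ (h.mapsTo w hw))).prodMk
    (contDiffAt_pi.2 fun a ↦ contDiffAt_pi.2 fun b ↦ h.contDiffAt_matrixEntry hw a b)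

theorem injective_fderiv_bundleCoord (hD : IsSO3Connection S D)
    (hinj : Function.Injective (mfderiv 𝓘(ℝ, F) IEnd Ψ w)) :
    Function.Injective (fderiv ℝ (C.bundleCoord Ψ) w) := by
  rw [injective_iff_map_eq_zero]
  intro u hu
  have hf : HasFDerivAt (C.bundleCoord Ψ) ((ContinuousLinearMap.pi fun i ↦ C.dcoord Ψ i w).prod
      (ContinuousLinearMap.pi fun a ↦ ContinuousLinearMap.pi fun b ↦
        fderiv ℝ (C.matrixEntry Ψ a b) w)) w :=
    (hasFDerivAt_pi.2 fun i ↦ ((h.contDiffAt_comp_proj hw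
      (C.smooth_coord i _ (h.mapsTo w hw))).differentiableAt (by simp)).hasFDerivAt).prodMk
    (hasFDerivAt_pi.2 fun a ↦ hasFDerivAt_pi.2 fun b ↦
      ((h.contDiffAt_matrixEntry hw a b).differentiableAt (by simp)).hasFDerivAt)
  rw [hf.fderiv] at hu
  have h1 : ∀ i, C.dcoord Ψ i w u = 0 := fun i ↦ congrFun (congrArg Prod.fst hu) i
  have h2 : ∀ a b, fderiv ℝ (C.matrixEntry Ψ a b) w u = 0 := fun a b ↦
    congrFun (congrFun (congrArg Prod.snd hu) a) b
  refine h.eq_zero_of_forms_eq_zero hw hD hinj (fun a ↦ ?_) fun a b ↦ ?_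
  · simp [coframe, h1]
  · simp [vertForm, connForm, h1, h2]

theorem contDiffAt_xiCoord (a : Fin 5) : ContDiffAt ℝ ∞ (C.xiCoord Ψ a) w :=
  contDiffAt_const.mul <| ContDiffAt.sum fun i _ ↦ ContDiffAt.sum fun j _ ↦ ContDiffAt.sum fun l _ ↦
    ContDiffAt.sum fun m _ ↦ ((h.contDiffAt_matrixEntry hw i j).mul
      (h.contDiffAt_matrixEntry hw l m)).mul contDiffAt_const

/-- The 1-forms `θ_a` and `V_ab` on a vector representing `χ`: the base component is `ξ_σ` and the
vertical part is zero. -/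
theorem forms_eq_of_mfderiv_eq_chi (hD : IsSO3Connection S D) {v : F}
    (hv : mfderiv 𝓘(ℝ, F) IEnd Ψ w v = chi S D (Ψ w)) :
    (∀ a, C.coframe Ψ a w v = C.xiCoord Ψ a w) ∧ ∀ a b, C.vertForm D Ψ a b w v = 0 := by
  refine ⟨fun a ↦ ?_, fun a b ↦ ?_⟩
  · rw [h.coframe_apply hw, hv, chi, dproj_horLift, h.inner_frame_xi hw]
  · rw [h.vertForm_apply hw hD, hv, chi, vertPart_horLift]
    simp

/-- In horizontal directions `ξ` is parallel, since its formula is `SO(5)`-equivariant and the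
connection is metric. -/
theorem fderiv_xiCoord (hD : IsSO3Connection S D) {v : F} (hv : ∀ a b, C.vertForm D Ψ a b w v = 0)
    (a : Fin 5) : fderiv ℝ (C.xiCoord Ψ a) w v =
      ∑ b, C.connForm D Ψ a b w v * C.xiCoord Ψ b w := by
  have hS : ∀ i j, fderiv ℝ (C.matrixEntry Ψ i j) w v =
      ∑ c, (C.matrixEntry Ψ i c w * C.connForm D Ψ j c w v
        + C.matrixEntry Ψ c j w * C.connForm D Ψ i c w v) := fun i j ↦ by
    have := hv i j
    simp only [vertForm, sub_apply, sum_apply, add_apply, smul_apply, smul_eq_mul] at this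
    linarith
  have hd := fun i j ↦ ((h.contDiffAt_matrixEntry hw i j).differentiableAt (by simp)).hasFDerivAt
  have hx : HasFDerivAt (C.xiCoord Ψ a) _ w := (HasFDerivAt.fun_sum (u := Finset.univ) fun i _ ↦
    HasFDerivAt.fun_sum (u := Finset.univ) fun j _ ↦
    HasFDerivAt.fun_sum (u := Finset.univ) fun l _ ↦
    HasFDerivAt.fun_sum (u := Finset.univ) fun m _ ↦ ((hd i j).mul (hd l m)).mul_const
      (leviCivita i j l m a)).const_mul (1 / 16 : ℝ)
  rw [hx.fderiv]
  refine Eq.trans ?_ (xiCoeff_infinitesimal (fun i j ↦ C.connForm D Ψ i j w v)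
    (fun i j ↦ h.connForm_skew hw hD i j v) (fun i j ↦ C.matrixEntry Ψ i j w) a)
  simp only [smul_apply, sum_apply, add_apply, smul_eq_mul, ← hS]
  congr 1
  refine Finset.sum_congr rfl fun i _ ↦ Finset.sum_congr rfl fun j _ ↦ Finset.sum_congr rfl
    fun l _ ↦ Finset.sum_congr rfl fun m _ ↦ ?_
  ring

/-- The base part of the geodesic equation in the direction of `χ`. By the structure equation the
sum has four parts: the one with torsion vanishes as the torsion is skew-symmetric, the one
quadratic in `ξ` vanishes as `ω` is skew-symmetric, and the remaining two cancel. -/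
theorem sum_coframe_eq_zero (hD : IsSO3Connection S D) (hT : HasSkewTorsion D) {v : F}
    (hv : ∀ a, C.coframe Ψ a w v = C.xiCoord Ψ a w) (l : F) :
    ∑ a, ((∑ b, C.connForm D Ψ a b w v * C.xiCoord Ψ b w) * C.coframe Ψ a w l
      + C.coframe Ψ a w v *
        (fderiv ℝ (C.coframe Ψ a) w v l - fderiv ℝ (C.coframe Ψ a) w l v)) = 0 := by
  have hy := h.mapsTo w hw
  have htor : ∑ a, C.coframe Ψ a w v * inner ℝ (C.frame a (Ψ w).1) (D.torsion (Ψ w).1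
      (dproj (Ψ w) (mfderiv 𝓘(ℝ, F) IEnd Ψ w v))
      (dproj (Ψ w) (mfderiv 𝓘(ℝ, F) IEnd Ψ w l))) = 0 := by
    rw [← hT.inner_torsion_self (dproj (Ψ w) (mfderiv 𝓘(ℝ, F) IEnd Ψ w v))
      (dproj (Ψ w) (mfderiv 𝓘(ℝ, F) IEnd Ψ w l)), ← C.sum_inner_mul_inner hy]
    exact Finset.sum_congr rfl fun a _ ↦ by rw [h.coframe_apply hw, real_inner_comm]
  have hskew : ∑ a, ∑ b, C.xiCoord Ψ a w * (C.connForm D Ψ a b w l * C.xiCoord Ψ b w) = 0 := by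
    have h1 : ∑ a, ∑ b, C.xiCoord Ψ a w * (C.connForm D Ψ a b w l * C.xiCoord Ψ b w) =
        - ∑ a, ∑ b, C.xiCoord Ψ a w * (C.connForm D Ψ a b w l * C.xiCoord Ψ b w) := by
      conv_lhs => rw [Finset.sum_comm]
      rw [← Finset.sum_neg_distrib]
      refine Finset.sum_congr rfl fun a _ ↦ ?_
      rw [← Finset.sum_neg_distrib]
      refine Finset.sum_congr rfl fun b _ ↦ ?_
      rw [h.connForm_skew hw hD b a]
      ring
    linarith
  have hcancel : ∑ a, (∑ b, C.connForm D Ψ a b w v * C.xiCoord Ψ b w) * C.coframe Ψ a w l =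
      - ∑ a, ∑ b, C.xiCoord Ψ a w * (C.connForm D Ψ a b w v * C.coframe Ψ b w l) := by
    simp only [Finset.sum_mul]
    rw [Finset.sum_comm, ← Finset.sum_neg_distrib]
    refine Finset.sum_congr rfl fun a _ ↦ ?_
    rw [← Finset.sum_neg_distrib]
    refine Finset.sum_congr rfl fun b _ ↦ ?_
    rw [h.connForm_skew hw hD b a]
    ring
  simp only [hv] at htor
  simp only [h.fderiv_coframe_sub hw hD, mul_add, Finset.sum_add_distrib, htor, hcancel, hv,
    Finset.mul_sum, mul_sub, Finset.sum_sub_distrib, hskew]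
  ring

end Adapted

section Curve
variable [FiniteDimensional ℝ F] (h : Adapted C Ψ W) {c : ℝ → F} {Γ : ℝ → EndBundle M} {u : ℝ}
  (hw : c u ∈ W) (hc : ContinuousAt c u)
  (hinj : ∀ w ∈ W, Function.Injective (mfderiv 𝓘(ℝ, F) IEnd Ψ w))
  (hD : IsSO3Connection S D) (hΓ : ∀ᶠ r in 𝓝 u, HasMFDerivAt 𝓘(ℝ, ℝ) IEnd Γ r
    ((1 : ℝ →L[ℝ] ℝ).smulRight (chi S D (Γ r)))) (hΨ : ∀ᶠ r in 𝓝 u, Γ r = Ψ (c r))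
include h hw hc hinj hD hΓ hΨ

namespace Adapted

/-- The coordinate curve is differentiable because `bundleCoord` is an immersion along it. -/
theorem eventually_differentiableAt : ∀ᶠ r in 𝓝 u, DifferentiableAt ℝ c r := by
  refine eventually_differentiableAt_of_immersion (Q := C.bundleCoord Ψ)
    ((h.contDiffAt_bundleCoord hw).of_le (by norm_cast))
    (h.injective_fderiv_bundleCoord hw hD (hinj _ hw)) hc ?_
  filter_upwards [hΓ, hΨ.eventually_nhds, hc.eventually (h.isOpen.mem_nhds hw)] with r h1 h2 h3
  have hd : MDifferentiableAt 𝓘(ℝ, ℝ) IEnd Γ r := h1.mdifferentiableAt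
  have hr : (Γ r).1 ∈ C.domain := by rw [h2.self_of_nhds]; exact h.mapsTo _ h3
  have hQ : DifferentiableAt ℝ (fun r ↦ ((fun i ↦ C.coord i (Γ r).1, fun a b ↦
      entry (C.frame a) (C.frame b) (Γ r)) : (Fin 5 → ℝ) × (Fin 5 → Fin 5 → ℝ))) r := by
    refine (differentiableAt_pi.2 fun i ↦ ?_).prodMk (differentiableAt_pi.2 fun a ↦
      differentiableAt_pi.2 fun b ↦ ?_)
    · exact (MDifferentiableAt.comp r ((C.smooth_coord i _ hr).mdifferentiableAt (by simp))
        (MDifferentiableAt.comp r (mdifferentiableAt_proj (EndFiber M)) hd)).differentiableAt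
    · exact (MDifferentiableAt.comp r ((contMDiff_entry (C.smooth_frame a)
        (C.smooth_frame b)).mdifferentiable (by simp) (Γ r)) hd).differentiableAt
  refine hQ.congr_of_eventuallyEq ?_
  filter_upwards [h2] with s hs
  rw [hs]
  rfl

theorem eventually_forms : ∀ᶠ r in 𝓝 u,
    (∀ a, C.coframe Ψ a (c r) (deriv c r) = C.xiCoord Ψ a (c r)) ∧
    ∀ a b, C.vertForm D Ψ a b (c r) (deriv c r) = 0 := by
  filter_upwards [hΓ, hΨ.eventually_nhds, hc.eventually (h.isOpen.mem_nhds hw),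
    h.eventually_differentiableAt hw hc hinj hD hΓ hΨ] with r h1 h2 h3 h4
  refine h.forms_eq_of_mfderiv_eq_chi h3 hD ?_
  have h5 := (h.mdifferentiableAt h3).hasMFDerivAt.comp r h4.hasDerivAt.hasFDerivAt.hasMFDerivAt
  have h6 := h1.congr_of_eventuallyEq (f₁ := Ψ ∘ c) (h2.mono fun _ h ↦ h.symm)
  have h7 := DFunLike.congr_fun (hasMFDerivAt_unique h5 h6) (1 : ℝ)
  -- The tangent spaces at `Γ r` and `Ψ (c r)` are both the model space `ℝ⁵ × End ℝ⁵`.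
  have h8 : (chi S D (Γ r) : R5 × (R5 →L[ℝ] R5)) = chi S D (Ψ (c r)) := by rw [h2.self_of_nhds]
  have h9 : mfderiv 𝓘(ℝ, F) IEnd Ψ (c r) ((1 : ℝ) • deriv c r) = (1 : ℝ) • chi S D (Γ r) := h7
  rw [one_smul, one_smul] at h9
  exact h9.trans h8

/-- The coordinate curve is an integral curve of a `C¹` vector field: its velocity is determined by
the values of `θ_a` and `V_ab`. -/
theorem exists_field : ∃ X : F → F, ContDiffAt ℝ 1 X (c u) ∧
    ∀ᶠ r in 𝓝 u, HasDerivAt c (X (c r)) r := by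
  let Θ : Fin 5 ⊕ Fin 5 × Fin 5 → F → F →L[ℝ] ℝ :=
    Sum.elim (C.coframe Ψ) fun p ↦ C.vertForm D Ψ p.1 p.2
  let ρ : Fin 5 ⊕ Fin 5 × Fin 5 → F → ℝ := Sum.elim (C.xiCoord Ψ) fun _ _ ↦ 0
  have hΘ : ∀ k, ContDiffAt ℝ 1 (Θ k) (c u) := by
    rintro (a | p)
    · exact (h.contDiffAt_coframe hw a).of_le (by norm_cast)
    · exact (h.contDiffAt_vertForm hw hD p.1 p.2).of_le (by norm_cast)
  have hρ : ∀ k, ContDiffAt ℝ 1 (ρ k) (c u) := by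
    rintro (a | p)
    · exact (h.contDiffAt_xiCoord hw a).of_le (by norm_cast)
    · exact contDiffAt_const
  -- The 1-forms `θ_a`, `V_ab` and their values on the velocity, as one linear system.
  let L : F → F →L[ℝ] (Fin 5 ⊕ Fin 5 × Fin 5 → ℝ) := fun w ↦
    ∑ k, (Θ k w).smulRight (Pi.single k (1 : ℝ))
  have hL : ∀ w x k, L w x k = Θ k w x := fun w x k ↦ by
    simp [L, -Fintype.sum_sum_type, Finset.sum_apply, Pi.single_apply]
  obtain ⟨X, hX, hXe⟩ := exists_field_of_clm_injective (L := L) (r := fun w k ↦ ρ k w) (w := c u)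
    (ContDiffAt.sum fun k _ ↦ (hΘ k).smulRight contDiffAt_const) (contDiffAt_pi.2 hρ) (by
      rw [injective_iff_map_eq_zero]
      intro x hx
      have hx' : ∀ k, Θ k (c u) x = 0 := fun k ↦ by rw [← hL, hx]; rfl
      exact h.eq_zero_of_forms_eq_zero hw hD (hinj _ hw) (fun a ↦ hx' (Sum.inl a))
        fun a b ↦ hx' (Sum.inr (a, b)))
  refine ⟨X, hX, ?_⟩
  filter_upwards [hc.eventually hXe, h.eventually_differentiableAt hw hc hinj hD hΓ hΨ,
    h.eventually_forms hw hc hinj hD hΓ hΨ] with r h1 h2 h3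
  rw [← h1 (deriv c r)]
  · exact h2.hasDerivAt
  · ext k
    rw [hL]
    rcases k with a | p
    · exact h3.1 a
    · exact h3.2 p.1 p.2

theorem contDiffAt_two : ContDiffAt ℝ 2 c u :=
  have ⟨_, hX, h'⟩ := h.exists_field hw hc hinj hD hΓ hΨ
  contDiffAt_two_of_hasDerivAt hX h'

theorem differentiableAt_deriv : DifferentiableAt ℝ (deriv c) u := by
  obtain ⟨X, hX, h'⟩ := h.exists_field hw hc hinj hD hΓ hΨ
  have h1 : DifferentiableAt ℝ (fun r ↦ X (c r)) u :=
    DifferentiableAt.comp u (hX.differentiableAt (by simp)) h'.self_of_nhds.differentiableAt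
  exact h1.congr_of_eventuallyEq (h'.mono fun r hr ↦ hr.deriv)

theorem hasDerivAt_form_deriv {Θ : F → F →L[ℝ] ℝ} (hΘ : DifferentiableAt ℝ Θ (c u)) :
    HasDerivAt (fun r ↦ Θ (c r) (deriv c r))
      (fderiv ℝ Θ (c u) (deriv c u) (deriv c u) + Θ (c u) (deriv (deriv c) u)) u := by
  have h1 := (h.eventually_differentiableAt hw hc hinj hD hΓ hΨ).self_of_nhds.hasDerivAt
  exact (hΘ.hasFDerivAt.comp_hasDerivAt u h1).clm_apply
    (h.differentiableAt_deriv hw hc hinj hD hΓ hΨ).hasDerivAt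

/-- The left-hand side is the derivative of `V_ab(c')`, which vanishes along the curve. -/
theorem fderiv_vertForm_add (a b : Fin 5) :
    fderiv ℝ (C.vertForm D Ψ a b) (c u) (deriv c u) (deriv c u)
      + C.vertForm D Ψ a b (c u) (deriv (deriv c) u) = 0 := by
  have h1 := h.hasDerivAt_form_deriv hw hc hinj hD hΓ hΨ
    ((h.contDiffAt_vertForm hw hD a b).differentiableAt (by simp))
  refine h1.unique ((hasDerivAt_const u (0 : ℝ)).congr_of_eventuallyEq ?_)
  filter_upwards [h.eventually_forms hw hc hinj hD hΓ hΨ] with r hr using hr.2 a b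

/-- The left-hand side is the derivative of `θ_a(c') = ⟪ξ, E_a⟫` along the curve. -/
theorem fderiv_coframe_add (a : Fin 5) :
    fderiv ℝ (C.coframe Ψ a) (c u) (deriv c u) (deriv c u)
      + C.coframe Ψ a (c u) (deriv (deriv c) u) =
    ∑ b, C.connForm D Ψ a b (c u) (deriv c u) * C.xiCoord Ψ b (c u) := by
  have h0 := h.eventually_forms hw hc hinj hD hΓ hΨ
  have h1 := h.hasDerivAt_form_deriv hw hc hinj hD hΓ hΨ
    ((h.contDiffAt_coframe hw a).differentiableAt (by simp))
  have h2 := ((h.contDiffAt_xiCoord hw a).differentiableAt (by simp)).hasFDerivAt.comp_hasDerivAt u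
    (h.eventually_differentiableAt hw hc hinj hD hΓ hΨ).self_of_nhds.hasDerivAt
  rw [← h.fderiv_xiCoord hw hD h0.self_of_nhds.2]
  refine h1.unique (h2.congr_of_eventuallyEq ?_)
  filter_upwards [h0] with r hr using hr.1 a

end Adapted
end Curve

/-- The geodesic equation for the metric coefficients `H` of the pulled back metric. -/
theorem Adapted.geodesic_equation {Ψ : R7 → EndBundle M} {W : Set R7} (h : Adapted C Ψ W)
    {c : ℝ → R7} {Γ : ℝ → EndBundle M} {u : ℝ}
    (hw : c u ∈ W) (hc : ContinuousAt c u)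
    (hinj : ∀ w ∈ W, Function.Injective (mfderiv 𝓘(ℝ, R7) IEnd Ψ w))
    (hD : IsSO3Connection S D) (hT : HasSkewTorsion D)
    (hΓ : ∀ᶠ r in 𝓝 u, HasMFDerivAt 𝓘(ℝ, ℝ) IEnd Γ r
      ((1 : ℝ →L[ℝ] ℝ).smulRight (chi S D (Γ r)))) (hΨ : ∀ᶠ r in 𝓝 u, Γ r = Ψ (c r)) (t : ℝ)
    (H : Fin 7 → Fin 7 → R7 → ℝ)
    (hH : ∀ i j w, H i j w = hMetric D t (Ψ w)
      (mfderiv 𝓘(ℝ, R7) IEnd Ψ w (EuclideanSpace.single i (1 : ℝ) : R7))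
      (mfderiv 𝓘(ℝ, R7) IEnd Ψ w (EuclideanSpace.single j (1 : ℝ) : R7))) (l : Fin 7) :
    ∑ k, H k l (c u) * deriv (deriv c) u k + ∑ i, ∑ j, 1 / 2 * (partialDeriv i (H j l) (c u)
      + partialDeriv j (H i l) (c u) - partialDeriv l (H i j) (c u))
        * deriv c u i * deriv c u j = 0 := by
  let Θ : Fin 5 ⊕ Fin 5 × Fin 5 → R7 → R7 →L[ℝ] ℝ :=
    Sum.elim (C.coframe Ψ) fun p ↦ C.vertForm D Ψ p.1 p.2
  have hΘ : ∀ k, DifferentiableAt ℝ (Θ k) (c u) := by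
    rintro (a | p)
    · exact (h.contDiffAt_coframe hw a).differentiableAt (by simp)
    · exact (h.contDiffAt_vertForm hw hD p.1 p.2).differentiableAt (by simp)
  rw [christoffel_sum_of_diagonal (Sum.elim (fun _ ↦ 1) fun _ ↦ t * (1 / 2)) Θ hΘ H]
  · have h0 := (h.eventually_forms hw hc hinj hD hΓ hΨ).self_of_nhds
    rw [Fintype.sum_sum_type]
    simp only [Sum.elim_inl, Sum.elim_inr, Θ, h.fderiv_vertForm_add hw hc hinj hD hΓ hΨ,
      h.fderiv_coframe_add hw hc hinj hD hΓ hΨ, h0.2, one_mul, zero_mul, add_zero, mul_zero,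
      Finset.sum_const_zero]
    exact h.sum_coframe_eq_zero hw hD hT h0.1 _
  · intro i j
    filter_upwards [h.isOpen.mem_nhds hw] with w hw'
    rw [hH, h.hMetric_mfderiv hw' hD, Fintype.sum_sum_type, Fintype.sum_prod_type]
    simp only [Sum.elim_inl, Sum.elim_inr, Θ, one_mul, ← Finset.mul_sum]
    ring

end OrientedChart

end Chart

end IrredSO3

end

theorem mainTheorem10 {M : Type*} [TopologicalSpace M] [T2Space M] [ChartedSpace R5 M]
    [IsManifold 𝓘(ℝ, R5) ∞ M]
    [RiemannianBundle (fun x : M ↦ TangentSpace 𝓘(ℝ, R5) x)]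
    [IsContMDiffRiemannianBundle 𝓘(ℝ, R5) ∞ R5 (fun x : M ↦ TangentSpace 𝓘(ℝ, R5) x)]
    (S : IrreducibleSO3Structure M) (D : Connection M)
    (hD : IsSO3Connection S D) (hT : HasSkewTorsion D) (t : ℝ) (ht : 0 < t)
    (J : Set ℝ) (hJ : IsOpen J) (hJ' : J.OrdConnected)
    (γ : ℝ → twistorSpace S)
    (hγ : IsMIntegralCurveOn (fun u ↦ (γ u : EndBundle M)) (chi S D) J) :
    IsGeodesicOn (hMetric D t) γ J := by
  have hcont : ContinuousOn γ J := fun u hu ↦ by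
    have h1 : ContinuousWithinAt (fun u ↦ (γ u : EndBundle M)) J u := (hγ u hu).continuousWithinAt
    exact Topology.IsInducing.subtypeVal.continuousWithinAt_iff.2 h1
  refine ⟨hcont, fun φ hφ u hu hs ↦ ?_⟩
  obtain ⟨C⟩ := nonempty_orientedChart S (γ u : EndBundle M).1
  have hA := OrientedChart.adapted_of_isCoordinateSystem hφ C
  have hγu : ContinuousAt γ u := hcont.continuousAt (hJ.mem_nhds hu)
  have hc : ContinuousAt (fun r ↦ φ (γ r)) u := ContinuousAt.comp (φ.continuousAt hs) hγu
  have hw : φ (γ u) ∈ φ.target ∩ φ.symm ⁻¹'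
      {p : twistorSpace S | (p : EndBundle M).1 ∈ C.domain} := by
    refine ⟨φ.map_source hs, ?_⟩
    change ((φ.symm (φ (γ u)) : twistorSpace S) : EndBundle M).1 ∈ C.domain
    rw [φ.left_inv hs]
    exact C.mem_domain
  have hΓ : ∀ᶠ r in 𝓝 u, HasMFDerivAt 𝓘(ℝ, ℝ) IEnd (fun r ↦ (γ r : EndBundle M)) r
      ((1 : ℝ →L[ℝ] ℝ).smulRight (chi S D (γ r))) := by
    filter_upwards [hJ.mem_nhds hu] with r hr using (hγ r hr).hasMFDerivAt (hJ.mem_nhds hr)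
  have hΨ : ∀ᶠ r in 𝓝 u, (γ r : EndBundle M) = (φ.symm (φ (γ r)) : twistorSpace S) := by
    filter_upwards [hγu.eventually (φ.open_source.mem_nhds hs)] with r hr
    rw [φ.left_inv hr]
  exact ⟨hA.contDiffAt_two hw hc (fun w hw' ↦ hφ.immersion w hw'.1) hD hΓ hΨ,
    hA.geodesic_equation hw hc (fun w hw' ↦ hφ.immersion w hw'.1) hD hT hΓ hΨ t
      (metricCoeff (hMetric D t) φ) fun _ _ _ ↦ rfl⟩
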